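/- Terms are those of the pure $\lambda$-calculus; $\simeq_\beta$ is $\beta$-equivalence and $\succ_f$ is weak head reduction in finitely many steps, generated by $(\lambda x\,u)\,v\,v_1\ldots v_m \to u[v/x]\,v_1\ldots v_m$. Types are those of system $\mathcal F$, built from type variables and type constants (among them a distinguished constant $\bot$) with $\to$ and $\forall$; $E$ and $S$ below are *proper* types, i.e. every quantified variable occurs in the scope of its quantifier. $\vdash_{\mathcal F}$ denotes Curry-style typability in system $\mathcal F$, and $\vdash_{\mathcal F_0}$ typability in $\mathcal F$ without the rule of $\forall$-elimination. Put $\neg A = A\to\bot$, and let $A^*$ (the Gödel translation) be $A$ with each atomic formula $R$ replaced by $\neg R$. A closed type $E$ is an *input type* if for every normal term $t$, $\vdash_{\mathcal F} t:E$ implies $\vdash_{\mathcal F_0} t:E$. A closed type $S$ is an *output type* if for every normal term $t$, $\vdash_{\mathcal F}\lambda x\,t:\forall X(X\to S)$ implies that $x$ is not free in $t$. A closed term $T$ is a *storage operator for the pair* $(E,S)$ if for every term $t$ with $\vdash_{\mathcal F} t:E$ there are terms $\tau,\tau'$ with $\tau\simeq_\beta\tau'$ and $\vdash_{\mathcal F}\tau':S$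 such that for every term $\theta\simeq_\beta t$ and every variable $f$ not free in $\theta$ there is a substitution $\sigma$ with $T\,\theta\,f\succ_f f\,\sigma(\tau)$. **Theorem.** Let $E$ be an input type and $S$ an output type in which $\bot$ does not occur. If $\vdash_{\mathcal F} T:E^*\to\neg\neg S$, then $T$ is a storage operator for the pair $(E,S)$. The output hypothesis on $S$ is necessary: if $E$ is a closed type with $\vdash_{\mathcal F} t:E$ for some term $t$, and $S$ is a closed type that is not an output type, then there is a term $T$ with $\vdash_{\mathcal F} T:E^*\to\neg\neg S$ that is not a storage operator for $(E,S)$. -/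

import Mathlib

namespace SystemF

/-! ### Pure λ-terms (de Bruijn indices) -/

/-- Terms of the pure λ-calculus; `var n` is the `n`-th variable, and under a `lam` the index `0`
refers to the bound variable while the other indices are shifted by one. -/
inductive Term : Type
  | var : ℕ → Term
  | app : Term → Term → Term
  | lam : Term → Term

namespace Term

/-- Renaming of variables, lifted under a binder. -/
def liftRen (r : ℕ → ℕ) : ℕ → ℕ
  | 0 => 0
  | n + 1 => r n + 1

/-- Capture-avoiding renaming of the free variables. -/
def rename : (ℕ → ℕ) → Term → Term
  | r, var n => var (r n)
  | r, app t u => app (rename r t) (rename r u)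
  | r, lam t => lam (rename (liftRen r) t)

/-- A substitution lifted under a binder. -/
def liftSub (s : ℕ → Term) : ℕ → Term
  | 0 => var 0
  | n + 1 => rename Nat.succ (s n)

/-- Capture-avoiding simultaneous substitution of terms for the free variables. -/
def subst : (ℕ → Term) → Term → Term
  | s, var n => s n
  | s, app t u => app (subst s t) (subst s u)
  | s, lam t => lam (subst (liftSub s) t)

/-- The substitution `0 ↦ v`, `n + 1 ↦ var n`. -/
def single (v : Term) : ℕ → Term
  | 0 => v
  | n + 1 => var n

/-- `u[v/x]`, where `x` is the variable of index `0` in `u`. -/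
def inst (u v : Term) : Term := subst (single v) u

/-- `IsFree n t`: the variable of index `n` is free in `t`. -/
def IsFree : ℕ → Term → Prop
  | n, var m => n = m
  | n, app t u => IsFree n t ∨ IsFree n u
  | n, lam t => IsFree (n + 1) t

/-- Terms without free variables. -/
def Closed (t : Term) : Prop := ∀ n, ¬ IsFree n t

/-- One step of β-reduction, anywhere in the term. -/
inductive Step : Term → Term → Prop
  | beta (u v : Term) : Step (app (lam u) v) (inst u v)
  | appL {t t' : Term} (u : Term) : Step t t' → Step (app t u) (app t' u)
  | appR (t : Term) {u u' : Term} : Step u u' → Step (app t u) (app t u')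
  | lam {t t' : Term} : Step t t' → Step (lam t) (lam t')

/-- β-equivalence. -/
def BetaEq : Term → Term → Prop := Relation.EqvGen Step

/-- β-normal terms. -/
def Normal (t : Term) : Prop := ∀ t', ¬ Step t t'

/-- One step of weak head reduction: `(λx u) v v₁ … vₘ` becomes `u[v/x] v₁ … vₘ`. -/
inductive WHStep : Term → Term → Prop
  | beta (u v : Term) : WHStep (app (lam u) v) (inst u v)
  | app {t t' : Term} (u : Term) : WHStep t t' → WHStep (app t u) (app t' u)

/-- Weak head reduction, in any finite number of steps. -/
def WHRed : Term → Term → Prop := Relation.ReflTransGen WHStep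

end Term

/-! ### Types of system F (de Bruijn indices for type variables) -/

/-- Types: variables, constants, arrows and universal quantification over types. -/
inductive Ty : Type
  | var : ℕ → Ty
  | cst : ℕ → Ty
  | arr : Ty → Ty → Ty
  | all : Ty → Ty

namespace Ty

/-- Renaming of type variables, lifted under a quantifier. -/
def liftRen (r : ℕ → ℕ) : ℕ → ℕ
  | 0 => 0
  | n + 1 => r n + 1

/-- Capture-avoiding renaming of the free type variables. -/
def rename : (ℕ → ℕ) → Ty → Ty
  | r, var n => var (r n)
  | _, cst c => cst c
  | r, arr A B => arr (rename r A) (rename r B)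
  | r, all A => all (rename (liftRen r) A)

/-- The type `A` seen under one more quantifier: no free variable becomes the index `0`. -/
def shift (A : Ty) : Ty := rename Nat.succ A

/-- A type substitution lifted under a quantifier. -/
def liftSub (s : ℕ → Ty) : ℕ → Ty
  | 0 => var 0
  | n + 1 => shift (s n)

/-- Capture-avoiding simultaneous substitution of types for the free type variables. -/
def subst : (ℕ → Ty) → Ty → Ty
  | s, var n => s n
  | _, cst c => cst c
  | s, arr A B => arr (subst s A) (subst s B)
  | s, all A => all (subst (liftSub s) A)

/-- The substitution `0 ↦ C`, `n + 1 ↦ var n`. -/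
def single (C : Ty) : ℕ → Ty
  | 0 => C
  | n + 1 => var n

/-- `A[C/X]`, where `X` is the type variable of index `0` in `A`. -/
def inst (A C : Ty) : Ty := subst (single C) A

/-- `IsFree n A`: the type variable of index `n` is free in `A`. -/
def IsFree : ℕ → Ty → Prop
  | n, var m => n = m
  | _, cst _ => False
  | n, arr A B => IsFree n A ∨ IsFree n B
  | n, all A => IsFree (n + 1) A

/-- Types without free type variables (constants are allowed). -/
def Closed (A : Ty) : Prop := ∀ n, ¬ IsFree n A

/-- Proper types: every quantified variable occurs in the scope of its quantifier. -/
def Proper : Ty → Prop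
  | var _ => True
  | cst _ => True
  | arr A B => Proper A ∧ Proper B
  | all A => IsFree 0 A ∧ Proper A

/-- The distinguished type constant `⊥`. -/
def bot : Ty := cst 0

/-- `CstOccurs c A`: the constant `cst c` occurs in `A`. -/
def CstOccurs (c : ℕ) : Ty → Prop
  | var _ => False
  | cst d => c = d
  | arr A B => CstOccurs c A ∨ CstOccurs c B
  | all A => CstOccurs c A

/-- `⊥` occurs in `A`. -/
def BotOccurs (A : Ty) : Prop := CstOccurs 0 A

/-- `¬A`, that is `A → ⊥`. -/
def neg (A : Ty) : Ty := arr A bot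

/-- The Gödel translation `A*`: every atomic formula `R` of `A` is replaced by `¬R`. -/
def star : Ty → Ty
  | var n => neg (var n)
  | cst c => neg (cst c)
  | arr A B => arr (star A) (star B)
  | all A => all (star A)

end Ty

/-! ### Typing -/

/-- `HasType Γ t A`: the judgement `Γ ⊢ t : A` of system F (Curry style). The `n`-th entry of the
list `Γ` is the type of the variable `n`; in the rule `allI` the context is shifted, which says
that the quantified variable is not free in it. -/
inductive HasType : List Ty → Term → Ty → Prop
  | ax {Γ : List Ty} {n : ℕ} {A : Ty} : Γ[n]? = some A → HasType Γ (Term.var n) A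
  | arrI {Γ : List Ty} {t : Term} {B C : Ty} :
      HasType (B :: Γ) t C → HasType Γ (Term.lam t) (Ty.arr B C)
  | arrE {Γ : List Ty} {u v : Term} {B C : Ty} :
      HasType Γ u (Ty.arr B C) → HasType Γ v B → HasType Γ (Term.app u v) C
  | allI {Γ : List Ty} {t : Term} {A : Ty} :
      HasType (Γ.map Ty.shift) t A → HasType Γ t (Ty.all A)
  | allE {Γ : List Ty} {t : Term} {A : Ty} (C : Ty) :
      HasType Γ t (Ty.all A) → HasType Γ t (Ty.inst A C)

/-- The system F₀: system F without the elimination rule of the quantifier. -/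
inductive HasType₀ : List Ty → Term → Ty → Prop
  | ax {Γ : List Ty} {n : ℕ} {A : Ty} : Γ[n]? = some A → HasType₀ Γ (Term.var n) A
  | arrI {Γ : List Ty} {t : Term} {B C : Ty} :
      HasType₀ (B :: Γ) t C → HasType₀ Γ (Term.lam t) (Ty.arr B C)
  | arrE {Γ : List Ty} {u v : Term} {B C : Ty} :
      HasType₀ Γ u (Ty.arr B C) → HasType₀ Γ v B → HasType₀ Γ (Term.app u v) C
  | allI {Γ : List Ty} {t : Term} {A : Ty} :
      HasType₀ (Γ.map Ty.shift) t A → HasType₀ Γ t (Ty.all A)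

/-! ### Input types, output types, storage operators -/

/-- Input types: closed types all of whose normal inhabitants are typable in F₀. -/
def IsInput (E : Ty) : Prop :=
  E.Closed ∧ ∀ t : Term, t.Normal → HasType [] t E → HasType₀ [] t E

/-- Output types: closed types `S` such that, for every normal `t`, if
`⊢ λx t : ∀X (X → S)` then `x` is not free in `t`. -/
def IsOutput (S : Ty) : Prop :=
  S.Closed ∧ ∀ t : Term, t.Normal →
    HasType [] (Term.lam t) (Ty.all (Ty.arr (Ty.var 0) S.shift)) → ¬ t.IsFree 0

/-- `T` is a storage operator for the pair `(E, S)`; the "new variable" `f` is any variable that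
is not free in `θ` (and not in `T`, which is closed). -/
def IsStorageOperator (T : Term) (E S : Ty) : Prop :=
  T.Closed ∧ ∀ t : Term, HasType [] t E →
    ∃ τ τ' : Term, Term.BetaEq τ τ' ∧ HasType [] τ' S ∧
      ∀ θ : Term, Term.BetaEq θ t → ∀ f : ℕ, ¬ θ.IsFree f →
        ∃ σ : ℕ → Term,
          Term.WHRed (Term.app (Term.app T θ) (Term.var f))
            (Term.app (Term.var f) (Term.subst σ τ))

end SystemF

/-! Sufficiency. Replace the argument of `T` by a variable of type `E*` and the continuation by a
variable of type `¬S`, and evaluate symbolically. The state always has type `⊥`, so it is never an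
abstraction: it either has a weak head redex or has a variable in head position. If that variable is
the continuation, typing forces the state to be the continuation applied to some `τ : S`, and the
run ends. Otherwise the variable stands for a closure, that is, a piece `w` of the normal form of
the input with an environment.

Such a `w` is unfolded along its F₀ derivation (`HasType₀.unfold_closure`): abstractions consume
arguments, and each argument subterm of `w` becomes a new variable. F₀ is what makes this typable,
since the Gödel translation commutes with every rule except the elimination of the quantifier
(`HasType₀.star`). Because `w` is normal, confluence and standardization show that every term
β-equivalent to `w` exposes the same outer constructor under weak head reduction. One symbolic run
therefore describes the real runs for all `θ` and `f` at once. It terminates (`World.eval`) because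
the real run on the normal form of the input is strongly normalizing, while symbolic steps that
contract nothing lower the index of the head variable.

The resulting `τ` is independent of `θ` and `f`, and its normal form is closed
(`World.closed_of_normal`): turn `⊥` into a type variable `X` and replace every free variable by
some `λ…λ z` with `z : X`. A free variable would leave `z` free in a normal inhabitant of `S`,
against the output hypothesis.

Necessity. If `u : S` is normal and really uses `x : X`, specialize `X` to `E*` and take `T = λx λf.
f u`. A stored `τ` would have as instances both `u[t₀/x]` and `u[(λy y) t₀/x]`, where `t₀` is a
normal inhabitant of `E`. One inserted term is an abstraction and the other an application, so `τ`
must have a free variable there and must be normal (`normal_of_separated`); then it cannot be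
β-equivalent to a closed term. -/

namespace SystemF

/-! ### Substitution calculus for terms. -/

namespace Term

theorem liftRen_comp (r r' : ℕ → ℕ) : liftRen r ∘ liftRen r' = liftRen (r ∘ r') := by
  funext n; cases n <;> rfl

theorem rename_rename (r r' : ℕ → ℕ) (t : Term) : rename r (rename r' t) = rename (r ∘ r') t := by
  induction t generalizing r r' with
  | var n => rfl
  | app t u iht ihu => simp [rename, iht, ihu]
  | lam t ih => simp [rename, ih, liftRen_comp]

theorem liftSub_comp_liftRen (s : ℕ → Term) (r : ℕ → ℕ) :
    liftSub s ∘ liftRen r = liftSub (s ∘ r) := by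
  funext n; cases n <;> rfl

theorem subst_rename (s : ℕ → Term) (r : ℕ → ℕ) (t : Term) :
    subst s (rename r t) = subst (s ∘ r) t := by
  induction t generalizing s r with
  | var n => rfl
  | app t u iht ihu => simp [rename, subst, iht, ihu]
  | lam t ih => simp [rename, subst, ih, liftSub_comp_liftRen]

theorem rename_comp_liftSub (r : ℕ → ℕ) (s : ℕ → Term) :
    rename (liftRen r) ∘ liftSub s = liftSub (rename r ∘ s) := by
  funext n
  cases n with
  | zero => rfl
  | succ n =>
    simp only [Function.comp, liftSub, rename_rename]
    rfl

theorem rename_subst (r : ℕ → ℕ) (s : ℕ → Term) (t : Term) :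
    rename r (subst s t) = subst (rename r ∘ s) t := by
  induction t generalizing s r with
  | var n => rfl
  | app t u iht ihu => simp [rename, subst, iht, ihu]
  | lam t ih => simp [rename, subst, ih, rename_comp_liftSub]

theorem subst_comp_liftSub (s s' : ℕ → Term) :
    subst (liftSub s) ∘ liftSub s' = liftSub (subst s ∘ s') := by
  funext n
  cases n with
  | zero => rfl
  | succ n =>
    simp only [Function.comp, liftSub, subst_rename, rename_subst]
    rfl

theorem subst_subst (s s' : ℕ → Term) (t : Term) :
    subst s (subst s' t) = subst (subst s ∘ s') t := by
  induction t generalizing s s' with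
  | var n => rfl
  | app t u iht ihu => simp [subst, iht, ihu]
  | lam t ih => simp [subst, ih, subst_comp_liftSub]

theorem liftSub_var : liftSub var = var := by
  funext n; cases n <;> rfl

@[simp] theorem subst_var (t : Term) : subst var t = t := by
  induction t with
  | var n => rfl
  | app t u iht ihu => simp [subst, iht, ihu]
  | lam t ih => simp [subst, ih, liftSub_var]

theorem rename_eq_subst (r : ℕ → ℕ) (t : Term) : rename r t = subst (var ∘ r) t := by
  rw [← subst_rename, subst_var]

/-- The substitution `0 ↦ v`, `n + 1 ↦ s n`. -/
def scons (v : Term) (s : ℕ → Term) : ℕ → Term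
  | 0 => v
  | n + 1 => s n

/-- Contracting a redex whose abstraction carries an environment amounts to pushing the argument
onto the environment; symbolic evaluation rests on this form of β. -/
theorem inst_subst_liftSub (s : ℕ → Term) (u v : Term) :
    inst (subst (liftSub s) u) v = subst (scons v s) u := by
  rw [inst, subst_subst]
  congr 1
  funext n
  cases n with
  | zero => rfl
  | succ n => simp only [Function.comp, liftSub, subst_rename, scons]; exact subst_var _

theorem subst_inst (s : ℕ → Term) (u v : Term) :
    subst s (inst u v) = inst (subst (liftSub s) u) (subst s v) := by
  rw [inst_subst_liftSub, inst, subst_subst]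
  congr 1
  funext n
  cases n <;> rfl

theorem rename_inst (r : ℕ → ℕ) (u v : Term) :
    rename r (inst u v) = inst (rename (liftRen r) u) (rename r v) := by
  rw [inst, inst, rename_subst, subst_rename]
  congr 1
  funext n
  cases n <;> rfl

@[simp] theorem inst_rename_succ (u v : Term) : inst (rename Nat.succ u) v = u := by
  rw [inst, subst_rename]
  exact subst_var u

theorem subst_congr {s s' : ℕ → Term} {t : Term} (h : ∀ n, IsFree n t → s n = s' n) :
    subst s t = subst s' t := by
  induction t generalizing s s' with
  | var n => exact h n rfl
  | app t u iht ihu =>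
    simp only [subst]
    rw [iht fun n hn => h n (Or.inl hn), ihu fun n hn => h n (Or.inr hn)]
  | lam t ih =>
    simp only [subst]
    rw [ih]
    intro n hn
    cases n with
    | zero => rfl
    | succ n => simp only [liftSub, h n hn]

theorem Closed.subst_eq {t : Term} (ht : t.Closed) (s : ℕ → Term) : subst s t = t := by
  rw [subst_congr (s' := var) fun n hn => absurd hn (ht n), subst_var]

theorem isFree_subst {s : ℕ → Term} {t : Term} {n : ℕ} :
    IsFree n (subst s t) ↔ ∃ m, IsFree m t ∧ IsFree n (s m) := by
  have hren : ∀ (r : ℕ → ℕ) (t : Term) (n : ℕ),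
      IsFree n (rename r t) ↔ ∃ m, IsFree m t ∧ n = r m := by
    intro r t
    induction t generalizing r with
    | var k => simp [rename, IsFree]
    | app t u iht ihu => intro n; simp only [rename, IsFree, iht, ihu]; aesop
    | lam t ih =>
      intro n
      simp only [rename, IsFree, ih]
      constructor
      · rintro ⟨m, hm, he⟩
        cases m with
        | zero => simp [liftRen] at he
        | succ m => exact ⟨m, hm, by simpa [liftRen] using he⟩
      · rintro ⟨m, hm, rfl⟩
        exact ⟨m + 1, hm, rfl⟩
  induction t generalizing s n with
  | var k => simp [subst, IsFree]
  | app t u iht ihu => simp only [subst, IsFree, iht, ihu]; aesop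
  | lam t ih =>
    simp only [subst, IsFree, ih]
    constructor
    · rintro ⟨m, hm, he⟩
      cases m with
      | zero => simp [liftSub, IsFree] at he
      | succ m =>
        simp only [liftSub, hren] at he
        obtain ⟨k, hk, e⟩ := he
        cases e
        exact ⟨m, hm, hk⟩
    · rintro ⟨m, hm, he⟩
      exact ⟨m + 1, hm, (hren _ _ _).2 ⟨n, he, rfl⟩⟩

end Term

/-! ### Substitution for type variables and for `⊥`. -/

namespace Ty

theorem liftRen_comp (r r' : ℕ → ℕ) : liftRen r ∘ liftRen r' = liftRen (r ∘ r') := by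
  funext n; cases n <;> rfl

theorem rename_rename (r r' : ℕ → ℕ) (A : Ty) : rename r (rename r' A) = rename (r ∘ r') A := by
  induction A generalizing r r' with
  | var n => rfl
  | cst c => rfl
  | arr A B ihA ihB => simp [rename, ihA, ihB]
  | all A ih => simp [rename, ih, liftRen_comp]

/-- Simultaneous substitution of `s` for the type variables and of `c` for the constant `⊥`. -/
def gsub : Ty → (ℕ → Ty) → Ty → Ty
  | _, s, var n => s n
  | c, _, cst 0 => c
  | _, _, cst (d + 1) => cst (d + 1)
  | c, s, arr A B => arr (gsub c s A) (gsub c s B)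
  | c, s, all A => all (gsub (shift c) (liftSub s) A)

theorem liftSub_comp_liftRen (s : ℕ → Ty) (r : ℕ → ℕ) :
    liftSub s ∘ liftRen r = liftSub (s ∘ r) := by
  funext n; cases n <;> rfl

theorem gsub_rename (c : Ty) (s : ℕ → Ty) (r : ℕ → ℕ) (A : Ty) :
    gsub c s (rename r A) = gsub c (s ∘ r) A := by
  induction A generalizing c s r with
  | var n => rfl
  | cst d => cases d <;> rfl
  | arr A B ihA ihB => simp [rename, gsub, ihA, ihB]
  | all A ih => simp [rename, gsub, ih, liftSub_comp_liftRen]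

theorem rename_shift (r : ℕ → ℕ) (A : Ty) : rename (liftRen r) (shift A) = shift (rename r A) := by
  simp only [shift, rename_rename]
  rfl

theorem rename_comp_liftSub (r : ℕ → ℕ) (s : ℕ → Ty) :
    rename (liftRen r) ∘ liftSub s = liftSub (rename r ∘ s) := by
  funext n
  cases n with
  | zero => rfl
  | succ n => exact rename_shift r (s n)

theorem rename_gsub (r : ℕ → ℕ) (c : Ty) (s : ℕ → Ty) (A : Ty) :
    rename r (gsub c s A) = gsub (rename r c) (rename r ∘ s) A := by
  induction A generalizing c s r with
  | var n => rfl
  | cst d => cases d <;> rfl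
  | arr A B ihA ihB => simp [rename, gsub, ihA, ihB]
  | all A ih => simp [rename, gsub, ih, rename_comp_liftSub, rename_shift]

theorem gsub_shift (c : Ty) (s : ℕ → Ty) (A : Ty) :
    gsub (shift c) (liftSub s) (shift A) = shift (gsub c s A) := by
  rw [shift, shift, shift, gsub_rename, rename_gsub]
  rfl

theorem gsub_comp_liftSub (c : Ty) (s s' : ℕ → Ty) :
    gsub (shift c) (liftSub s) ∘ liftSub s' = liftSub (gsub c s ∘ s') := by
  funext n
  cases n with
  | zero => rfl
  | succ n => exact gsub_shift c s (s' n)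

theorem gsub_gsub (c c' : Ty) (s s' : ℕ → Ty) (A : Ty) :
    gsub c s (gsub c' s' A) = gsub (gsub c s c') (gsub c s ∘ s') A := by
  induction A generalizing c c' s s' with
  | var n => rfl
  | cst d => cases d <;> rfl
  | arr A B ihA ihB => simp [gsub, ihA, ihB]
  | all A ih => simp [gsub, ih, gsub_comp_liftSub, gsub_shift]

/-- Ordinary substitution is the case where `⊥` is fixed, so one calculus serves both for
instantiation and for the later replacement of `⊥` by a type variable. -/
theorem subst_eq_gsub (s : ℕ → Ty) (A : Ty) : subst s A = gsub bot s A := by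
  induction A generalizing s with
  | var n => rfl
  | cst d => cases d <;> rfl
  | arr A B ihA ihB => simp [subst, gsub, ihA, ihB]
  | all A ih => simp only [subst, gsub, ih]; rfl

theorem inst_eq_gsub (A C : Ty) : inst A C = gsub bot (single C) A := subst_eq_gsub _ _

theorem gsub_eq_self {c : Ty} {s : ℕ → Ty} {A : Ty} (hs : ∀ n, IsFree n A → s n = var n)
    (hc : c = bot ∨ ¬ BotOccurs A) : gsub c s A = A := by
  induction A generalizing c s with
  | var n => exact hs n rfl
  | cst d =>
    cases d with
    | zero =>
      rcases hc with rfl | h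
      · rfl
      · exact absurd rfl h
    | succ d => rfl
  | arr A B ihA ihB =>
    simp only [BotOccurs, CstOccurs, not_or] at hc
    simp only [gsub]
    rw [ihA (fun n hn => hs n (Or.inl hn)) (hc.imp_right And.left),
      ihB (fun n hn => hs n (Or.inr hn)) (hc.imp_right And.right)]
  | all A ih =>
    simp only [gsub]
    rw [ih]
    · intro n hn
      cases n with
      | zero => rfl
      | succ n => simp only [liftSub, hs n hn]; rfl
    · rcases hc with rfl | h
      · exact Or.inl rfl
      · exact Or.inr h

@[simp] theorem gsub_bot_var (A : Ty) : gsub bot var A = A :=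
  gsub_eq_self (fun _ _ => rfl) (Or.inl rfl)

theorem gsub_inst (c : Ty) (s : ℕ → Ty) (A C : Ty) :
    gsub c s (inst A C) = inst (gsub (shift c) (liftSub s) A) (gsub c s C) := by
  have h : gsub bot (single (gsub c s C)) (shift c) = c := by
    rw [shift, gsub_rename]; exact gsub_bot_var c
  rw [inst_eq_gsub, inst_eq_gsub, gsub_gsub, gsub_gsub, h]
  congr 1
  funext n
  cases n with
  | zero => rfl
  | succ n =>
    simp only [Function.comp, liftSub, shift, gsub_rename]
    exact (gsub_bot_var _).symm

/-- The type substitution `0 ↦ C`, `n + 1 ↦ s n`. -/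
def scons (C : Ty) (s : ℕ → Ty) : ℕ → Ty
  | 0 => C
  | n + 1 => s n

theorem inst_gsub_liftSub (s : ℕ → Ty) (A C : Ty) :
    inst (gsub bot (liftSub s) A) C = gsub bot (scons C s) A := by
  rw [inst_eq_gsub, gsub_gsub]
  congr 1
  funext n
  cases n with
  | zero => rfl
  | succ n =>
    simp only [Function.comp, liftSub, shift, gsub_rename]
    exact gsub_bot_var _

theorem gsub_scons_shift (c C : Ty) (s : ℕ → Ty) (A : Ty) :
    gsub c (scons C s) (shift A) = gsub c s A := by
  rw [shift, gsub_rename]; rfl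

@[simp] theorem inst_shift (A C : Ty) : inst (shift A) C = A := by
  rw [inst_eq_gsub, shift, gsub_rename]
  exact gsub_bot_var A

theorem Closed.shift_eq {A : Ty} (hA : A.Closed) : shift A = A := by
  have h : shift A = gsub bot (var ∘ Nat.succ) A := by
    rw [← gsub_rename, gsub_bot_var]; rfl
  rw [h]
  exact gsub_eq_self (fun n hn => absurd hn (hA n)) (Or.inl rfl)

theorem star_rename (r : ℕ → ℕ) (A : Ty) : star (rename r A) = rename r (star A) := by
  induction A generalizing r with
  | var n => rfl
  | cst d => rfl
  | arr A B ihA ihB => simp [rename, star, ihA, ihB]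
  | all A ih => simp [rename, star, ih]

end Ty

namespace Term

/-! ### β-reduction -/

/-- β-reduction in finitely many steps. -/
def Red : Term → Term → Prop := Relation.ReflTransGen Step

theorem Red.appL {t t' : Term} (u : Term) (h : Red t t') : Red (app t u) (app t' u) :=
  Relation.ReflTransGen.lift (fun x => app x u) (fun _ _ h => Step.appL u h) _ _ h

theorem Red.appR (t : Term) {u u' : Term} (h : Red u u') : Red (app t u) (app t u') :=
  Relation.ReflTransGen.lift (fun x => app t x) (fun _ _ h => Step.appR t h) _ _ h

theorem Red.app {t t' u u' : Term} (h : Red t t') (h' : Red u u') : Red (app t u) (app t' u') :=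
  (h.appL u).trans (h'.appR t')

theorem Red.lam {t t' : Term} (h : Red t t') : Red (lam t) (lam t') :=
  Relation.ReflTransGen.lift Term.lam (fun _ _ h => Step.lam h) _ _ h

theorem Red.betaEq {t t' : Term} (h : Red t t') : BetaEq t t' := by
  induction h with
  | refl => exact .refl _
  | tail _ h ih => exact .trans _ _ _ ih (.rel _ _ h)

theorem BetaEq.symm {t t' : Term} (h : BetaEq t t') : BetaEq t' t := Relation.EqvGen.symm _ _ h

theorem BetaEq.trans {t t' t'' : Term} (h : BetaEq t t') (h' : BetaEq t' t'') : BetaEq t t'' :=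
  Relation.EqvGen.trans _ _ _ h h'

theorem Step.subst {t t' : Term} (h : Step t t') (s : ℕ → Term) :
    Step (subst s t) (subst s t') := by
  induction h generalizing s with
  | beta u v =>
    rw [subst_inst]
    exact .beta _ _
  | appL u _ ih => exact .appL _ (ih s)
  | appR t _ ih => exact .appR _ (ih s)
  | lam _ ih => exact .lam (ih _)

theorem Step.isFree {t t' : Term} (h : Step t t') {n : ℕ} (hn : IsFree n t') : IsFree n t := by
  induction h generalizing n with
  | beta u v =>
    rw [inst, isFree_subst] at hn
    obtain ⟨m, hm, hn⟩ := hn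
    cases m with
    | zero => exact Or.inr hn
    | succ m =>
      cases hn
      exact Or.inl hm
  | appL u _ ih => exact hn.imp_left ih
  | appR t _ ih => exact hn.imp_right ih
  | lam _ ih => exact ih hn

theorem Red.isFree {t t' : Term} (h : Red t t') {n : ℕ} (hn : IsFree n t') : IsFree n t := by
  induction h with
  | refl => exact hn
  | tail _ h ih => exact ih (h.isFree hn)

theorem normal_lam {t : Term} : Normal (lam t) ↔ Normal t :=
  ⟨fun h _ ht => h _ (.lam ht), fun h _ ht => by cases ht with | lam ht => exact h _ ht⟩

theorem normal_var (n : ℕ) : Normal (var n) := fun _ h => by cases h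

theorem normal_app {t u : Term} :
    Normal (app t u) ↔ Normal t ∧ Normal u ∧ ∀ v, t ≠ lam v := by
  constructor
  · intro h
    refine ⟨fun _ ht => h _ (.appL _ ht), fun _ ht => h _ (.appR _ ht), ?_⟩
    rintro v rfl
    exact h _ (.beta _ _)
  · rintro ⟨h₁, h₂, h₃⟩ _ ht
    cases ht with
    | beta v _ => exact h₃ v rfl
    | appL _ ht => exact h₁ _ ht
    | appR _ ht => exact h₂ _ ht

theorem Normal.red_eq {t t' : Term} (ht : Normal t) (h : Red t t') : t' = t := by
  rcases Relation.ReflTransGen.cases_head h with h | ⟨_, h, _⟩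
  · exact h.symm
  · exact absurd h (ht _)

/-- The left spine of such a term ends in a variable that nothing binds. Consequently closed normal
terms are abstractions. -/
theorem Normal.exists_isFree {t : Term} (ht : Normal t) (hl : ∀ v, t ≠ lam v) :
    ∃ n, IsFree n t := by
  induction t with
  | var n => exact ⟨n, rfl⟩
  | app t u iht _ =>
    obtain ⟨h₁, -, h₃⟩ := normal_app.1 ht
    obtain ⟨n, hn⟩ := iht h₁ h₃
    exact ⟨n, Or.inl hn⟩
  | lam t _ => exact absurd rfl (hl t)

/-! ### Confluence -/

/-- Parallel β-reduction. -/
inductive Par : Term → Term → Prop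
  | var (n : ℕ) : Par (var n) (var n)
  | app {t t' u u' : Term} : Par t t' → Par u u' → Par (app t u) (app t' u')
  | lam {t t' : Term} : Par t t' → Par (lam t) (lam t')
  | beta {t t' u u' : Term} : Par t t' → Par u u' → Par (app (lam t) u) (inst t' u')

theorem Par.refl (t : Term) : Par t t := by
  induction t with
  | var n => exact .var n
  | app t u iht ihu => exact .app iht ihu
  | lam t ih => exact .lam ih

theorem Par.rename {t t' : Term} (h : Par t t') (r : ℕ → ℕ) :
    Par (rename r t) (rename r t') := by
  induction h generalizing r with
  | var n => exact .var _
  | app _ _ iht ihu => exact .app (iht r) (ihu r)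
  | lam _ ih => exact .lam (ih _)
  | beta _ _ iht ihu =>
    rw [rename_inst]
    exact .beta (iht _) (ihu r)

theorem Par.subst {t t' : Term} (h : Par t t') {s s' : ℕ → Term} (hs : ∀ n, Par (s n) (s' n)) :
    Par (subst s t) (subst s' t') := by
  have hlift : ∀ {s s' : ℕ → Term}, (∀ n, Par (s n) (s' n)) →
      ∀ n, Par (liftSub s n) (liftSub s' n) := by
    intro s s' hs n
    cases n with
    | zero => exact .var 0
    | succ n => exact (hs n).rename _
  induction h generalizing s s' with
  | var n => exact hs n
  | app _ _ iht ihu => exact .app (iht hs) (ihu hs)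
  | lam _ ih => exact .lam (ih (hlift hs))
  | beta _ _ iht ihu =>
    rw [subst_inst]
    exact .beta (iht (hlift hs)) (ihu hs)

theorem Par.inst {t t' u u' : Term} (h : Par t t') (h' : Par u u') :
    Par (inst t u) (inst t' u') := by
  refine h.subst fun n => ?_
  cases n with
  | zero => exact h'
  | succ n => exact .var n

theorem Step.par {t t' : Term} (h : Step t t') : Par t t' := by
  induction h with
  | beta u v => exact .beta (.refl _) (.refl _)
  | appL u _ ih => exact .app ih (.refl _)
  | appR t _ ih => exact .app (.refl _) ih
  | lam _ ih => exact .lam ih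

theorem Par.red {t t' : Term} (h : Par t t') : Red t t' := by
  induction h with
  | var n => exact .refl
  | app _ _ iht ihu => exact iht.app ihu
  | lam _ ih => exact ih.lam
  | beta _ _ iht ihu => exact (iht.lam.app ihu).tail (.beta _ _)

/-- The complete development: all redexes of the term are contracted at once. -/
def dev : Term → Term
  | var n => var n
  | lam t => lam (dev t)
  | app (lam t) u => inst (dev t) (dev u)
  | app (var n) u => app (var n) (dev u)
  | app (app t t') u => app (dev (app t t')) (dev u)

/-- Takahashi's triangle property: whatever redexes were contracted, contracting the remaining ones
leads to the complete development. The diamond property of `Par` is immediate. -/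
theorem Par.dev {t t' : Term} (h : Par t t') : Par t' (dev t) := by
  induction h with
  | var n => exact .var n
  | @app t t' u u' ht hu iht ihu =>
    cases ht with
    | var n => exact .app (.var n) ihu
    | app h₁ h₂ => exact .app iht ihu
    | beta h₁ h₂ => exact .app iht ihu
    | lam h =>
      cases iht with
      | lam iht => exact .beta iht ihu
  | lam _ ih => exact .lam ih
  | beta _ _ iht ihu => exact iht.inst ihu

theorem BetaEq.join {t t' : Term} (h : BetaEq t t') : ∃ u, Red t u ∧ Red t' u := by
  have hred : ∀ {a b}, Relation.ReflTransGen Par a b → Red a b := by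
    intro a b h
    induction h with
    | refl => exact .refl
    | tail _ h ih => exact ih.trans h.red
  have hcr : ∀ a b c, Par a b → Par a c →
      ∃ d, Relation.ReflGen Par b d ∧ Relation.ReflTransGen Par c d :=
    fun a b c hb hc => ⟨dev a, .single hb.dev, .single hc.dev⟩
  have heq := Relation.equivalence_join_reflTransGen hcr
  have : Relation.Join (Relation.ReflTransGen Par) t t' := by
    induction h with
    | rel a b h => exact ⟨b, .single h.par, .refl⟩
    | refl a => exact heq.refl a
    | symm a b _ ih => exact heq.symm ih
    | trans a b c _ _ ih ih' => exact heq.trans ih ih'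
  obtain ⟨u, hu, hu'⟩ := this
  exact ⟨u, hred hu, hred hu'⟩

theorem BetaEq.red {t t' : Term} (h : BetaEq t t') (ht' : Normal t') : Red t t' := by
  obtain ⟨u, hu, hu'⟩ := h.join
  rwa [ht'.red_eq hu'] at hu

/-! ### Weak head reduction and standardization -/

theorem WHStep.step {t t' : Term} (h : WHStep t t') : Step t t' := by
  induction h with
  | beta u v => exact .beta _ _
  | app u _ ih => exact .appL _ ih

theorem WHRed.red {t t' : Term} (h : WHRed t t') : Red t t' :=
  Relation.ReflTransGen.mono (fun _ _ h => WHStep.step h) _ _ h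

theorem WHRed.app {t t' : Term} (h : WHRed t t') (u : Term) :
    WHRed (Term.app t u) (Term.app t' u) :=
  Relation.ReflTransGen.lift (fun x => Term.app x u) (fun _ _ h => WHStep.app u h) _ _ h

theorem WHStep.subst {t t' : Term} (h : WHStep t t') (s : ℕ → Term) :
    WHStep (subst s t) (subst s t') := by
  induction h with
  | beta u v =>
    rw [subst_inst]
    exact .beta _ _
  | app u _ ih => exact .app _ ih

theorem WHRed.subst {t t' : Term} (h : WHRed t t') (s : ℕ → Term) :
    WHRed (subst s t) (subst s t') :=
  Relation.ReflTransGen.lift (Term.subst s) (fun _ _ h => WHStep.subst h s) _ _ h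

theorem WHStep.det {t u v : Term} (h : WHStep t u) (h' : WHStep t v) : u = v := by
  induction h generalizing v with
  | beta a b =>
    cases h' with
    | beta => rfl
    | app _ h' => cases h'
  | app b h ih =>
    cases h' with
    | beta => cases h
    | app _ h' => rw [ih h']

theorem WHRed.eq_of_halted {t u v : Term} (h : WHRed t u) (h' : WHRed t v)
    (hu : ∀ w, ¬ WHStep u w) (hv : ∀ w, ¬ WHStep v w) : u = v := by
  induction h using Relation.ReflTransGen.head_induction_on with
  | refl =>
    rcases Relation.ReflTransGen.cases_head h' with h | ⟨_, h, _⟩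
    · exact h
    · exact absurd h (hu _)
  | head h _ ih =>
    rcases Relation.ReflTransGen.cases_head h' with rfl | ⟨_, h'', h'''⟩
    · exact absurd h (hv _)
    · cases h.det h''
      exact ih h'''

/-- Standard reduction: weak head reduction, followed by standard reductions of the immediate
subterms. -/
inductive St : Term → Term → Prop
  | var {t : Term} {n : ℕ} : WHRed t (var n) → St t (var n)
  | app {t u u' v v' : Term} : WHRed t (app u v) → St u u' → St v v' → St t (app u' v')
  | lam {t u u' : Term} : WHRed t (lam u) → St u u' → St t (lam u')

theorem St.refl (t : Term) : St t t := by
  induction t with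
  | var n => exact .var .refl
  | app t u iht ihu => exact .app .refl iht ihu
  | lam t ih => exact .lam .refl ih

theorem St.head {t t' u : Term} (h : WHRed t t') (h' : St t' u) : St t u := by
  cases h' with
  | var h' => exact .var (h.trans h')
  | app h' h₁ h₂ => exact .app (h.trans h') h₁ h₂
  | lam h' h₁ => exact .lam (h.trans h') h₁

theorem St.red {t t' : Term} (h : St t t') : Red t t' := by
  induction h with
  | var h => exact h.red
  | app h _ _ ih₁ ih₂ => exact h.red.trans (ih₁.app ih₂)
  | lam h _ ih => exact h.red.trans ih.lam

theorem St.rename {t t' : Term} (h : St t t') (r : ℕ → ℕ) : St (rename r t) (rename r t') := by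
  have hw : ∀ {t t' : Term}, WHRed t t' → ∀ r, WHRed (Term.rename r t) (Term.rename r t') := by
    intro t t' h r
    rw [rename_eq_subst, rename_eq_subst]
    exact h.subst _
  induction h generalizing r with
  | var h => exact .var (hw h r)
  | app h _ _ ih₁ ih₂ => exact .app (hw h r) (ih₁ r) (ih₂ r)
  | lam h _ ih => exact .lam (hw h r) (ih _)

theorem St.subst {t t' : Term} (h : St t t') {s s' : ℕ → Term} (hs : ∀ n, St (s n) (s' n)) :
    St (subst s t) (subst s' t') := by
  induction h generalizing s s' with
  | var h => exact (hs _).head (h.subst s)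
  | app h _ _ ih₁ ih₂ => exact .app (h.subst s) (ih₁ hs) (ih₂ hs)
  | lam h _ ih =>
    refine .lam (h.subst s) (ih fun n => ?_)
    cases n with
    | zero => exact .refl _
    | succ n => exact (hs n).rename _

/-- The heart of standardization. If the new step contracts a redex at the root, the abstraction was
already exposed by weak head reduction, so the contraction joins the head phase and the remaining
standard reductions are combined by `St.subst`. -/
theorem St.step {t u v : Term} (h : St t u) (h' : Step u v) : St t v := by
  induction h' generalizing t with
  | beta u v =>
    cases h with
    | app h h₁ h₂ =>
      cases h₁ with
      | lam h₁ h₃ =>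
        refine St.head ((h.trans (h₁.app _)).tail (.beta _ _)) (h₃.subst fun n => ?_)
        cases n with
        | zero => exact h₂
        | succ n => exact .refl _
  | appL u _ ih => cases h with | app h h₁ h₂ => exact .app h (ih h₁) h₂
  | appR t _ ih => cases h with | app h h₁ h₂ => exact .app h h₁ (ih h₂)
  | lam _ ih => cases h with | lam h h₁ => exact .lam h (ih h₁)

theorem Red.st {t u : Term} (h : Red t u) : St t u := by
  induction h with
  | refl => exact .refl _
  | tail _ h ih => exact ih.step h

/-- Here and in the next two lemmas the target is normal, so confluence turns β-equivalence into
reduction and standardization extracts its weak head part. This makes evaluation uniform in `θ`. -/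
theorem BetaEq.whRed_var {t : Term} {n : ℕ} (h : BetaEq t (var n)) : WHRed t (var n) := by
  cases (h.red (normal_var n)).st with
  | var h => exact h

theorem BetaEq.whRed_lam {t u : Term} (h : BetaEq t (lam u)) (hu : Normal (lam u)) :
    ∃ u', WHRed t (lam u') ∧ BetaEq u' u := by
  cases (h.red hu).st with
  | lam h h' => exact ⟨_, h, h'.red.betaEq⟩

theorem BetaEq.whRed_app {t u v : Term} (h : BetaEq t (app u v)) (hu : Normal (app u v)) :
    ∃ u' v', WHRed t (app u' v') ∧ BetaEq u' u ∧ BetaEq v' v := by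
  cases (h.red hu).st with
  | app h h₁ h₂ => exact ⟨_, _, h, h₁.red.betaEq, h₂.red.betaEq⟩

end Term

/-! ### Structural properties of typing -/

theorem map_gsub_shift (c : Ty) (s : ℕ → Ty) (Γ : List Ty) :
    (Γ.map Ty.shift).map (Ty.gsub c.shift (Ty.liftSub s)) = (Γ.map (Ty.gsub c s)).map Ty.shift := by
  simp [Ty.gsub_shift]

theorem map_gsub_scons_shift (c C : Ty) (s : ℕ → Ty) (Γ : List Ty) :
    (Γ.map Ty.shift).map (Ty.gsub c (Ty.scons C s)) = Γ.map (Ty.gsub c s) := by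
  simp [Ty.gsub_scons_shift]

theorem map_gsub_bot_var (Γ : List Ty) : Γ.map (Ty.gsub Ty.bot Ty.var) = Γ :=
  List.map_id'' Ty.gsub_bot_var Γ

namespace HasType

theorem congr_ctx {Γ Γ' : List Ty} {t : Term} {A : Ty} (h : HasType Γ t A)
    (hΓ : ∀ n, t.IsFree n → ∀ B, Γ[n]? = some B → Γ'[n]? = some B) : HasType Γ' t A := by
  induction h generalizing Γ' with
  | ax h => exact .ax (hΓ _ rfl _ h)
  | arrI _ ih =>
    refine .arrI (ih fun n hn B hB => ?_)
    cases n with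
    | zero => exact hB
    | succ n => exact hΓ n hn B (by simpa using hB)
  | arrE _ _ ih₁ ih₂ =>
    exact .arrE (ih₁ fun n hn => hΓ n (Or.inl hn)) (ih₂ fun n hn => hΓ n (Or.inr hn))
  | allI _ ih =>
    refine .allI (ih fun n hn B hB => ?_)
    simp only [List.getElem?_map, Option.map_eq_some_iff] at hB ⊢
    obtain ⟨D, hD, rfl⟩ := hB
    exact ⟨D, hΓ n hn D hD, rfl⟩
  | allE C _ ih => exact .allE C (ih hΓ)

theorem lt_length {Γ : List Ty} {t : Term} {A : Ty} (h : HasType Γ t A) {n : ℕ}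
    (hn : t.IsFree n) : n < Γ.length := by
  induction h generalizing n with
  | ax h =>
    cases hn
    exact (List.getElem?_eq_some_iff.1 h).1
  | arrI _ ih => simpa using ih hn
  | arrE _ _ ih₁ ih₂ => exact hn.elim ih₁ ih₂
  | allI _ ih => simpa using ih hn
  | allE C _ ih => exact ih hn

theorem closed {t : Term} {A : Ty} (h : HasType [] t A) : t.Closed := fun _ hn =>
  absurd (h.lt_length hn) (Nat.not_lt_zero _)

theorem append {Γ : List Ty} {t : Term} {A : Ty} (h : HasType Γ t A) (Γ' : List Ty) :
    HasType (Γ ++ Γ') t A :=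
  h.congr_ctx fun _ _ _ hB => by
    rw [List.getElem?_append_left (List.getElem?_eq_some_iff.1 hB).1, hB]

theorem rename {Γ Γ' : List Ty} {t : Term} {A : Ty} (h : HasType Γ t A) {r : ℕ → ℕ}
    (hr : ∀ n B, Γ[n]? = some B → Γ'[r n]? = some B) : HasType Γ' (t.rename r) A := by
  induction h generalizing Γ' r with
  | ax h => exact .ax (hr _ _ h)
  | arrI _ ih =>
    refine .arrI (ih fun n B hB => ?_)
    cases n with
    | zero => exact hB
    | succ n => exact hr n B (by simpa using hB)
  | arrE _ _ ih₁ ih₂ => exact .arrE (ih₁ hr) (ih₂ hr)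
  | allI _ ih =>
    refine .allI (ih fun n B hB => ?_)
    simp only [List.getElem?_map, Option.map_eq_some_iff] at hB ⊢
    obtain ⟨D, hD, rfl⟩ := hB
    exact ⟨D, hr n D hD, rfl⟩
  | allE C _ ih => exact .allE C (ih hr)

theorem gsub {Γ : List Ty} {t : Term} {A : Ty} (h : HasType Γ t A) (c : Ty) (s : ℕ → Ty) :
    HasType (Γ.map (Ty.gsub c s)) t (Ty.gsub c s A) := by
  induction h generalizing c s with
  | ax h => exact .ax (by simp [h])
  | arrI _ ih => exact .arrI (ih c s)
  | arrE _ _ ih₁ ih₂ => exact .arrE (ih₁ c s) (ih₂ c s)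
  | allI _ ih =>
    refine .allI ?_
    rw [← map_gsub_shift]
    exact ih _ _
  | allE C _ ih =>
    rw [Ty.gsub_inst]
    exact .allE _ (ih c s)

theorem shift {Γ : List Ty} {t : Term} {A : Ty} (h : HasType Γ t A) :
    HasType (Γ.map Ty.shift) t A.shift := by
  have e : Ty.shift = Ty.gsub Ty.bot (Ty.var ∘ Nat.succ) := by
    funext A
    rw [← Ty.gsub_rename, Ty.gsub_bot_var]
    rfl
  rw [e]
  exact h.gsub _ _

theorem subst {Γ Γ' : List Ty} {t : Term} {A : Ty} (h : HasType Γ t A) {s : ℕ → Term}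
    (hs : ∀ n B, Γ[n]? = some B → HasType Γ' (s n) B) : HasType Γ' (t.subst s) A := by
  induction h generalizing Γ' s with
  | ax h => exact hs _ _ h
  | arrI _ ih =>
    refine .arrI (ih fun n B hB => ?_)
    cases n with
    | zero => exact .ax hB
    | succ n => exact (hs n B (by simpa using hB)).rename fun m D hD => by simpa using hD
  | arrE _ _ ih₁ ih₂ => exact .arrE (ih₁ hs) (ih₂ hs)
  | allI _ ih =>
    refine .allI (ih fun n B hB => ?_)
    simp only [List.getElem?_map, Option.map_eq_some_iff] at hB
    obtain ⟨D, hD, rfl⟩ := hB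
    exact (hs n D hD).shift
  | allE C _ ih => exact .allE C (ih hs)

theorem inst {Γ : List Ty} {u v : Term} {A B : Ty} (hu : HasType (B :: Γ) u A)
    (hv : HasType Γ v B) : HasType Γ (u.inst v) A := by
  refine hu.subst fun n D hD => ?_
  cases n with
  | zero =>
    cases hD
    exact hv
  | succ n => exact .ax (by simpa using hD)

end HasType

/-- `LamType Γ t A`: the type `A` is `∀X₁ … ∀Xₙ (B → C)`, and `t` has type `C` in the context `Γ`
extended by `B`. -/
inductive LamType : List Ty → Term → Ty → Prop
  | arr {Γ : List Ty} {t : Term} {B C : Ty} : HasType (B :: Γ) t C → LamType Γ t (Ty.arr B C)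
  | all {Γ : List Ty} {t : Term} {A : Ty} : LamType (Γ.map Ty.shift) t A → LamType Γ t (Ty.all A)

theorem LamType.gsub {Γ : List Ty} {t : Term} {A : Ty} (h : LamType Γ t A) (c : Ty) (s : ℕ → Ty) :
    LamType (Γ.map (Ty.gsub c s)) t (Ty.gsub c s A) := by
  induction h generalizing c s with
  | arr h => exact .arr (h.gsub c s)
  | all _ ih =>
    refine .all ?_
    rw [← map_gsub_shift]
    exact ih _ _

/-- A quantifier eliminated above an abstraction must have been introduced above it; substituting
the instance through the derivation cancels the two rules. Subject reduction and the absence of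
abstractions of type `⊥` both follow. -/
theorem HasType.lamType {Γ : List Ty} {t : Term} {A : Ty} (h : HasType Γ (.lam t) A) :
    LamType Γ t A := by
  generalize e : Term.lam t = u at h
  induction h with
  | ax => cases e
  | arrI h => cases e; exact .arr h
  | arrE => cases e
  | allI _ ih => exact .all (ih e)
  | allE C _ ih =>
    cases ih e with
    | all h =>
      have := h.gsub Ty.bot (Ty.single C)
      rw [← Ty.inst_eq_gsub] at this
      have e' : Ty.single C = Ty.scons C Ty.var := by funext n; cases n <;> rfl
      rwa [e', map_gsub_scons_shift, map_gsub_bot_var] at this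

theorem HasType.of_lam {Γ : List Ty} {t : Term} {A B : Ty}
    (h : HasType Γ (.lam t) (.arr A B)) : HasType (A :: Γ) t B := by
  cases h.lamType with
  | arr h => exact h

theorem HasType.step {Γ : List Ty} {t t' : Term} {A : Ty} (h : HasType Γ t A)
    (ht : Term.Step t t') : HasType Γ t' A := by
  induction h generalizing t' with
  | ax => cases ht
  | arrI _ ih => cases ht with | lam ht => exact .arrI (ih ht)
  | arrE h₁ h₂ ih₁ ih₂ =>
    cases ht with
    | beta => exact h₁.of_lam.inst h₂
    | appL _ ht => exact .arrE (ih₁ ht) h₂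
    | appR _ ht => exact .arrE h₁ (ih₂ ht)
  | allI _ ih => exact .allI (ih ht)
  | allE C _ ih => exact .allE C (ih ht)

theorem HasType.red {Γ : List Ty} {t t' : Term} {A : Ty} (h : HasType Γ t A)
    (ht : Term.Red t t') : HasType Γ t' A := by
  induction ht with
  | refl => exact h
  | tail _ ht ih => exact ih.step ht

theorem map_star_shift (Γ : List Ty) :
    (Γ.map Ty.shift).map Ty.star = (Γ.map Ty.star).map Ty.shift := by
  simp [Ty.shift, Ty.star_rename]

/-- The translation commutes with the F₀ rules. It would fail for the elimination of the quantifier: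
`(A[C/X])*` has `C*` where an instance of `A*` at `C` has `¬C`. -/
theorem HasType₀.star {Γ : List Ty} {t : Term} {A : Ty} (h : HasType₀ Γ t A) :
    HasType (Γ.map Ty.star) t A.star := by
  induction h with
  | ax h => exact .ax (by simp [h])
  | arrI _ ih => exact .arrI ih
  | arrE _ _ ih₁ ih₂ => exact .arrE ih₁ ih₂
  | allI _ ih =>
    rw [map_star_shift] at ih
    exact .allI ih

/-! ### Strong normalization -/

namespace Term

/-- Strongly normalizing terms. -/
def SN (t : Term) : Prop := Acc (fun a b => Step b a) t

theorem SN.step {t t' : Term} (h : SN t) (ht : Step t t') : SN t' := h.inv ht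

theorem SN.exists_normal {t : Term} (h : SN t) : ∃ t', Red t t' ∧ Normal t' := by
  induction h with
  | intro t _ ih =>
    by_cases hn : Normal t
    · exact ⟨t, .refl, hn⟩
    · simp only [Normal, not_forall, not_not] at hn
      obtain ⟨u, hu⟩ := hn
      obtain ⟨t', h, h'⟩ := ih u hu
      exact ⟨t', h.head hu, h'⟩

theorem SN.of_app {t u : Term} (h : SN (app t u)) : SN t := by
  generalize e : app t u = v at h
  induction h generalizing t with
  | intro v _ ih =>
    subst e
    exact .intro _ fun t' ht => ih _ (.appL u ht) rfl

/-- Reducibility candidates. -/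
structure Candidate (P : Set Term) : Prop where
  sn : ∀ t ∈ P, SN t
  step : ∀ t ∈ P, ∀ t', Step t t' → t' ∈ P
  neutral : ∀ t, (∀ u, t ≠ lam u) → (∀ t', Step t t' → t' ∈ P) → t ∈ P

theorem Candidate.var_mem {P : Set Term} (h : Candidate P) (n : ℕ) : var n ∈ P :=
  h.neutral _ (fun _ e => by cases e) fun _ ht => by cases ht

theorem candidate_sn : Candidate {t | SN t} where
  sn _ h := h
  step _ h _ ht := SN.step h ht
  neutral _ _ h := .intro _ h

/-- The set of terms that map `P` into `Q`. -/
def arrow (P Q : Set Term) : Set Term := {t | ∀ u ∈ P, app t u ∈ Q}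

theorem Candidate.arrow {P Q : Set Term} (hP : Candidate P) (hQ : Candidate Q) :
    Candidate (arrow P Q) where
  sn t h := (hQ.sn _ (h _ (hP.var_mem 0))).of_app
  step t h t' ht u hu := hQ.step _ (h u hu) _ (.appL u ht)
  neutral t hn h u hu := by
    have hsn := hP.sn u hu
    induction hsn with
    | intro u _ ih =>
      refine hQ.neutral _ (fun _ e => by cases e) fun v hv => ?_
      cases hv with
      | beta w => exact absurd rfl (hn w)
      | appL _ ht => exact h _ ht u hu
      | appR _ hu' => exact ih _ hu' (hP.step _ hu _ hu')

theorem Candidate.lam_mem {P Q : Set Term} (hP : Candidate P) (hQ : Candidate Q) {t : Term}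
    (h : ∀ u ∈ P, inst t u ∈ Q) : lam t ∈ Term.arrow P Q := by
  -- Steps of the body survive the substitution of a variable, so strong normalization of that
  -- instance passes back to the body. The main argument then inducts on both the body and the
  -- argument.
  have hbody : SN t := by
    have h0 : SN (inst t (var 0)) := hQ.sn _ (h _ (hP.var_mem 0))
    generalize e : inst t (var 0) = v at h0
    clear h
    induction h0 generalizing t with
    | intro v _ ih =>
      subst e
      exact .intro _ fun t' ht => ih _ (ht.subst _) rfl
  intro u hu
  have hsn := hP.sn u hu
  induction hbody generalizing u with
  | intro t _ iht =>
    induction hsn with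
    | intro u hacc ihu =>
      refine hQ.neutral _ (fun _ e => by cases e) fun v hv => ?_
      cases hv with
      | beta => exact h u hu
      | appL _ ht =>
        cases ht with
        | lam ht =>
          exact iht _ ht (fun u hu => hQ.step _ (h u hu) _ (ht.subst _)) u hu (.intro _ hacc)
      | appR _ hu' => exact ihu _ hu' (hP.step _ hu _ hu')

end Term

open Term

/-- The interpretation of a type under a valuation of the type variables by sets of terms. -/
def Ty.interp : (ℕ → Set Term) → Ty → Set Term
  | ξ, .var n => ξ n
  | _, .cst _ => {t | SN t}
  | ξ, .arr A B => arrow (A.interp ξ) (B.interp ξ)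
  | ξ, .all A => {t | ∀ P, Candidate P → t ∈ A.interp (fun n => n.casesOn P ξ)}

theorem Ty.candidate_interp (A : Ty) {ξ : ℕ → Set Term} (hξ : ∀ n, Candidate (ξ n)) :
    Candidate (A.interp ξ) := by
  induction A generalizing ξ with
  | var n => exact hξ n
  | cst c => exact candidate_sn
  | arr A B ihA ihB => exact (ihA hξ).arrow (ihB hξ)
  | all A ih =>
    have hc : ∀ P, Candidate P → Candidate (A.interp (fun n => n.casesOn P ξ)) := by
      intro P hP
      refine ih fun n => ?_
      cases n with
      | zero => exact hP
      | succ n => exact hξ n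
    exact
      { sn := fun t h => (hc _ candidate_sn).sn t (h _ candidate_sn)
        step := fun t h t' ht P hP => (hc P hP).step t (h P hP) t' ht
        neutral := fun t hn h P hP => (hc P hP).neutral t hn fun t' ht => h t' ht P hP }

theorem Ty.interp_rename (r : ℕ → ℕ) (A : Ty) (ξ : ℕ → Set Term) :
    (A.rename r).interp ξ = A.interp (ξ ∘ r) := by
  induction A generalizing r ξ with
  | var n => rfl
  | cst c => rfl
  | arr A B ihA ihB => simp only [rename, interp, ihA, ihB]
  | all A ih =>
    simp only [rename, interp, ih]
    ext t
    refine forall₂_congr fun P _ => iff_of_eq (congrArg (fun ζ => t ∈ A.interp ζ) ?_)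
    funext n
    cases n <;> rfl

theorem Ty.interp_subst (s : ℕ → Ty) (A : Ty) (ξ : ℕ → Set Term) :
    (A.subst s).interp ξ = A.interp (fun n => (s n).interp ξ) := by
  induction A generalizing s ξ with
  | var n => rfl
  | cst c => rfl
  | arr A B ihA ihB => simp only [subst, interp, ihA, ihB]
  | all A ih =>
    simp only [subst, interp, ih]
    ext t
    refine forall₂_congr fun P _ => iff_of_eq (congrArg (fun ζ => t ∈ A.interp ζ) ?_)
    funext n
    cases n with
    | zero => rfl
    | succ n => exact interp_rename _ _ _

/-- The fundamental lemma of reducibility. Quantifier elimination is sound because the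
interpretation of a type is itself a candidate. -/
theorem HasType.mem_interp {Γ : List Ty} {t : Term} {A : Ty} (h : HasType Γ t A)
    {ξ : ℕ → Set Term} (hξ : ∀ n, Candidate (ξ n)) {s : ℕ → Term}
    (hs : ∀ n B, Γ[n]? = some B → s n ∈ B.interp ξ) : t.subst s ∈ A.interp ξ := by
  induction h generalizing ξ s with
  | ax h => exact hs _ _ h
  | @arrI Γ t B C _ ih =>
    refine (B.candidate_interp hξ).lam_mem (C.candidate_interp hξ) fun u hu => ?_
    rw [inst_subst_liftSub]
    refine ih hξ fun n D hD => ?_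
    cases n with
    | zero =>
      cases hD
      exact hu
    | succ n => exact hs n D (by simpa using hD)
  | arrE _ _ ih₁ ih₂ => exact ih₁ hξ hs _ (ih₂ hξ hs)
  | allI _ ih =>
    intro P hP
    refine ih (fun n => ?_) fun n B hB => ?_
    · cases n with
      | zero => exact hP
      | succ n => exact hξ n
    · simp only [List.getElem?_map, Option.map_eq_some_iff] at hB
      obtain ⟨D, hD, rfl⟩ := hB
      rw [Ty.shift, Ty.interp_rename]
      exact hs n D hD
  | @allE Γ t A C _ ih =>
    rw [Ty.inst, Ty.interp_subst]
    have := ih hξ hs _ (C.candidate_interp hξ)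
    convert this using 2
    funext n
    cases n <;> rfl

theorem HasType.sn {Γ : List Ty} {t : Term} {A : Ty} (h : HasType Γ t A) : SN t := by
  have hξ : ∀ _ : ℕ, Candidate {t | SN t} := fun _ => candidate_sn
  have := h.mem_interp hξ (s := Term.var) fun n B _ => (B.candidate_interp hξ).var_mem n
  rw [subst_var] at this
  exact (A.candidate_interp hξ).sn _ this

theorem HasType.exists_normal {Γ : List Ty} {t : Term} {A : Ty} (h : HasType Γ t A) :
    ∃ t', Red t t' ∧ t'.Normal ∧ HasType Γ t' A := by
  obtain ⟨t', h₁, h₂⟩ := h.sn.exists_normal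
  exact ⟨t', h₁, h₂, h.red h₁⟩

/-! ### Head variables, argument lists and environments. -/

namespace Term

/-- The application `t b₁ … bₙ`. -/
def appN (t : Term) (bs : List Term) : Term := bs.foldl app t

theorem subst_appN (s : ℕ → Term) (t : Term) (bs : List Term) :
    subst s (appN t bs) = appN (subst s t) (bs.map (subst s)) := by
  induction bs generalizing t with
  | nil => rfl
  | cons b bs ih => exact ih (app t b)

theorem WHStep.appN {t t' : Term} (h : WHStep t t') (bs : List Term) :
    WHStep (t.appN bs) (t'.appN bs) := by
  induction bs generalizing t t' with
  | nil => exact h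
  | cons b bs ih => exact ih (.app b h)

theorem WHRed.appN {t t' : Term} (h : WHRed t t') (bs : List Term) :
    WHRed (t.appN bs) (t'.appN bs) :=
  Relation.ReflTransGen.lift (fun x => Term.appN x bs) (fun _ _ h => WHStep.appN h bs) _ _ h

/-- The head variable of `t b₁ … bₙ` and its arguments, when the head of `t` is a variable. -/
def unwind : Term → List Term → Option (ℕ × List Term)
  | var x, bs => some (x, bs)
  | app t u, bs => unwind t (u :: bs)
  | lam _, _ => none

theorem appN_eq_of_unwind {t : Term} {bs cs : List Term} {x : ℕ}
    (h : unwind t bs = some (x, cs)) : appN t bs = appN (var x) cs := by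
  induction t generalizing bs with
  | var n =>
    simp only [unwind, Option.some.injEq, Prod.mk.injEq] at h
    rw [h.1, h.2]
  | app t u iht _ => exact iht h
  | lam t _ => cases h

theorem isFree_of_unwind {t : Term} {bs cs : List Term} {x : ℕ}
    (h : unwind t bs = some (x, cs)) : IsFree x t := by
  induction t generalizing bs with
  | var n =>
    simp only [unwind, Option.some.injEq, Prod.mk.injEq] at h
    exact h.1.symm
  | app t u iht _ => exact Or.inl (iht h)
  | lam t _ => cases h

theorem unwind_appN (t : Term) (bs cs : List Term) :
    unwind (appN t bs) cs = unwind t (bs ++ cs) := by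
  induction bs generalizing t with
  | nil => rfl
  | cons b bs ih => exact ih (app t b)

theorem whStep_or_lam_or_unwind (t : Term) :
    (∃ t', WHStep t t') ∨ (∃ u, t = lam u) ∨ ∀ bs, ∃ x cs, unwind t bs = some (x, cs) := by
  induction t with
  | var n => exact Or.inr (Or.inr fun bs => ⟨n, bs, rfl⟩)
  | app t u iht _ =>
    rcases iht with ⟨t', h⟩ | ⟨v, rfl⟩ | h
    · exact Or.inl ⟨_, .app u h⟩
    · exact Or.inl ⟨_, .beta v u⟩
    · exact Or.inr (Or.inr fun bs => h (u :: bs))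
  | lam t _ => exact Or.inr (Or.inl ⟨t, rfl⟩)

/-- The substitution given by a list of terms; it shifts down the variables beyond the list. -/
def envSub : List Term → ℕ → Term
  | [] => var
  | b :: l => scons b (envSub l)

theorem envSub_eq {l : List Term} {n : ℕ} {c : Term} (h : l[n]? = some c) : envSub l n = c := by
  induction l generalizing n with
  | nil => simp at h
  | cons b l ih =>
    cases n with
    | zero => simpa [envSub, scons] using h
    | succ n => exact ih (by simpa using h)

/-- All free variables of the terms of `a` are below `k`. -/
def Below (k : ℕ) (a : List Term) : Prop := ∀ c ∈ a, ∀ n, IsFree n c → n < k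

theorem Below.map_subst_congr {k : ℕ} {a : List Term} (ha : Below k a) {σ σ' : ℕ → Term}
    (h : ∀ n < k, σ n = σ' n) : a.map (subst σ) = a.map (subst σ') :=
  List.map_congr_left fun c hc => subst_congr fun n hn => h n (ha c hc n hn)

end Term

/-! ### Eliminations of a head variable -/

/-- `Spine Δ A bs`: a term of type `A` applied to the arguments `bs` gets the type `⊥` by
eliminations only. -/
inductive Spine (Δ : List Ty) : Ty → List Term → Prop
  | nil : Spine Δ Ty.bot []
  | cons {A B : Ty} {b : Term} {bs : List Term} :
      HasType Δ b A → Spine Δ B bs → Spine Δ (Ty.arr A B) (b :: bs)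
  | inst {A : Ty} {bs : List Term} (C : Ty) : Spine Δ (A.inst C) bs → Spine Δ (Ty.all A) bs

theorem Spine.hasType {Δ : List Ty} {A : Ty} {bs : List Term} (h : Spine Δ A bs) {t : Term}
    (ht : HasType Δ t A) : HasType Δ (t.appN bs) Ty.bot := by
  induction h generalizing t with
  | nil => exact ht
  | cons hb _ ih => exact ih (.arrE ht hb)
  | inst C _ ih => exact ih (.allE C ht)

theorem Spine.append {Δ : List Ty} {A : Ty} {bs : List Term} (h : Spine Δ A bs) (Δ' : List Ty) :
    Spine (Δ ++ Δ') A bs := by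
  induction h with
  | nil => exact .nil
  | cons hb _ ih => exact .cons (hb.append Δ') ih
  | inst C _ ih => exact .inst C ih

theorem Spine.args_below {Δ : List Ty} {A : Ty} {bs : List Term} (h : Spine Δ A bs) :
    Below Δ.length bs := by
  induction h with
  | nil => intro c hc; cases hc
  | cons hb _ ih =>
    intro c hc
    rcases List.mem_cons.1 hc with rfl | hc
    · exact fun n hn => hb.lt_length hn
    · exact ih c hc
  | inst C _ ih => exact ih

/-- The derivation is followed down to the head variable while the arguments met are collected. A
quantifier introduced on the way is instantiated by the spine above it; `s` accumulates these
instances, which is why the statement is up to a type substitution. -/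
theorem HasType.spine_gsub {Δ : List Ty} {t : Term} {D : Ty} (h : HasType Δ t D) {s : ℕ → Ty}
    {bs cs : List Term} {x : ℕ} (hs : Spine (Δ.map (Ty.gsub Ty.bot s)) (Ty.gsub Ty.bot s D) bs)
    (hx : unwind t bs = some (x, cs)) :
    ∃ A, Δ[x]? = some A ∧ Spine (Δ.map (Ty.gsub Ty.bot s)) (Ty.gsub Ty.bot s A) cs := by
  induction h generalizing s bs with
  | ax h =>
    simp only [unwind, Option.some.injEq, Prod.mk.injEq] at hx
    rw [← hx.1, ← hx.2]
    exact ⟨_, h, hs⟩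
  | arrI => cases hx
  | arrE _ h₂ ih₁ _ => exact ih₁ (.cons (h₂.gsub _ _) hs) hx
  | @allI Δ t A _ ih =>
    simp only [Ty.gsub] at hs
    cases hs with
    | inst C hs =>
      have e : Ty.shift Ty.bot = Ty.bot := rfl
      rw [e, Ty.inst_gsub_liftSub, ← map_gsub_scons_shift _ C] at hs
      obtain ⟨B, hB, h⟩ := ih hs hx
      simp only [List.getElem?_map, Option.map_eq_some_iff] at hB
      obtain ⟨A', hA', rfl⟩ := hB
      rw [map_gsub_scons_shift, Ty.gsub_scons_shift] at h
      exact ⟨A', hA', h⟩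
  | allE C _ ih =>
    rw [Ty.gsub_inst] at hs
    exact ih (.inst _ hs) hx

theorem HasType.spine {Δ : List Ty} {t : Term} (h : HasType Δ t Ty.bot) {cs : List Term} {x : ℕ}
    (hx : unwind t [] = some (x, cs)) : ∃ A, Δ[x]? = some A ∧ Spine Δ A cs := by
  have := h.spine_gsub (s := Ty.var) (bs := []) .nil hx
  simpa only [map_gsub_bot_var, Ty.gsub_bot_var] using this

/-! ### Symbolic evaluation -/

/-- The terms of `a` have in `Δ` the types that the Gödel translation and the type substitution
`s` make of those of `Γ`. -/
def EnvType (Δ : List Ty) (s : ℕ → Ty) (a : List Term) (Γ : List Ty) : Prop :=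
  List.Forall₂ (fun c B => HasType Δ c (Ty.gsub Ty.bot s (Ty.star B))) a Γ

theorem EnvType.below {Δ : List Ty} {s : ℕ → Ty} {a : List Term} {Γ : List Ty}
    (h : EnvType Δ s a Γ) : Below Δ.length a := by
  induction h with
  | nil => intro c hc; cases hc
  | cons hb _ ih =>
    intro c hc
    rcases List.mem_cons.1 hc with rfl | hc
    · exact fun n hn => hb.lt_length hn
    · exact ih c hc

theorem EnvType.append {Δ : List Ty} {s : ℕ → Ty} {a : List Term} {Γ : List Ty}
    (h : EnvType Δ s a Γ) (Δ' : List Ty) : EnvType (Δ ++ Δ') s a Γ :=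
  List.Forall₂.imp (fun _ _ h => h.append Δ') h

theorem EnvType.get {Δ : List Ty} {s : ℕ → Ty} {a : List Term} {Γ : List Ty}
    (h : EnvType Δ s a Γ) {n : ℕ} {B : Ty} (hB : Γ[n]? = some B) :
    ∃ c, a[n]? = some c ∧ HasType Δ c (Ty.gsub Ty.bot s B.star) := by
  induction h generalizing n with
  | nil => simp at hB
  | cons hb _ ih =>
    cases n with
    | zero =>
      simp only [List.getElem?_cons_zero, Option.some.injEq] at hB
      subst hB
      exact ⟨_, rfl, hb⟩
    | succ n => exact ih (by simpa using hB)

theorem EnvType.of_shift {Δ : List Ty} {s : ℕ → Ty} {a : List Term} {Γ : List Ty}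
    (h : EnvType Δ s a Γ) (C : Ty) : EnvType Δ (Ty.scons C s) a (Γ.map Ty.shift) := by
  rw [EnvType, List.forall₂_map_right_iff]
  refine List.Forall₂.imp (fun c B h => ?_) h
  have e : Ty.star (Ty.shift B) = Ty.shift (Ty.star B) := Ty.star_rename _ _
  rwa [e, Ty.gsub_scons_shift]

/-- The variables of `Δ` stand for the continuation, of type `¬S`, and for closures: the closure
`p + 1` is a normal term typable in F₀, with an environment that mentions earlier variables only.
The valuations in `V` replace the code of each closure by some β-equivalent term. -/
structure World (S : Ty) (Δ : List Ty) (V : Set (ℕ → Term)) : Prop where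
  zero : Δ[0]? = some S.neg
  closure : ∀ p D, Δ[p + 1]? = some D → ∃ w a Γ A s, HasType₀ Γ w A ∧ w.Normal ∧
    D = Ty.gsub Ty.bot s A.star ∧ EnvType (Δ.take (p + 1)) s a Γ ∧
    ∀ σ ∈ V, ∃ w', BetaEq w' w ∧ σ (p + 1) = w'.subst (envSub (a.map (subst σ)))

theorem World.length_pos {S : Ty} {Δ : List Ty} {V : Set (ℕ → Term)} (h : World S Δ V) :
    0 < Δ.length := (List.getElem?_eq_some_iff.1 h.zero).1

/-- New valuations agree with old ones below `Δ.length`, and old environments mention only those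
variables, so the old closures keep their values. -/
theorem World.push {S : Ty} {Δ : List Ty} {V : Set (ℕ → Term)} (h : World S Δ V) {w : Term}
    {a : List Term} {Γ : List Ty} {A : Ty} {s : ℕ → Ty} (hw : HasType₀ Γ w A) (hn : w.Normal)
    (ha : EnvType Δ s a Γ) :
    World S (Δ ++ [Ty.gsub Ty.bot s A.star])
      {σ' | ∃ σ ∈ V, (∀ n < Δ.length, σ' n = σ n) ∧
        ∃ w', BetaEq w' w ∧ σ' Δ.length = w'.subst (envSub (a.map (subst σ)))} where
  zero := by rw [List.getElem?_append_left h.length_pos, h.zero]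
  closure p D hD := by
    have hp : p + 1 < Δ.length ∨ p + 1 = Δ.length := by
      have := (List.getElem?_eq_some_iff.1 hD).1
      simp only [List.length_append, List.length_singleton] at this
      omega
    rcases hp with hp | hp
    · rw [List.getElem?_append_left hp] at hD
      obtain ⟨w, a, Γ, A, s, h₁, h₂, h₃, h₄, h₅⟩ := h.closure p D hD
      refine ⟨w, a, Γ, A, s, h₁, h₂, h₃, ?_, ?_⟩
      · rwa [List.take_append_of_le_length hp.le]
      · rintro σ' ⟨σ, hσ, hag, -⟩
        obtain ⟨w', hw', e⟩ := h₅ σ hσ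
        refine ⟨w', hw', ?_⟩
        rw [hag _ hp, e, h₄.below.map_subst_congr fun n hn => (hag n ?_).symm]
        rw [List.length_take] at hn
        omega
    · rw [hp, List.getElem?_append_right le_rfl] at hD
      simp only [Nat.sub_self, List.getElem?_cons_zero, Option.some.injEq] at hD
      refine ⟨w, a, Γ, A, s, hw, hn, hD.symm, ?_, ?_⟩
      · rwa [hp, List.take_append_of_le_length le_rfl, List.take_length]
      · rintro σ' ⟨σ, hσ, hag, w', hw', e⟩
        refine ⟨w', hw', ?_⟩
        rw [hp, e, ha.below.map_subst_congr fun n hn => (hag n hn).symm]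

/-- A closure in head position is evaluated until its code gives way to a term `c` of its
environment, or to one of the arguments, in which case a redex has been contracted. -/
theorem HasType₀.unfold_closure {S : Ty} {Γ : List Ty} {w : Term} {A : Ty} (h : HasType₀ Γ w A)
    (hn : w.Normal) {Δ : List Ty} {V : Set (ℕ → Term)} (hW : World S Δ V) {s : ℕ → Ty}
    {a bs : List Term} (ha : EnvType Δ s a Γ) (hbs : Spine Δ (Ty.gsub Ty.bot s A.star) bs) :
    ∃ Δ' V' c cs, World S Δ' V' ∧ HasType Δ' (appN c cs) Ty.bot ∧
      ∀ σ ∈ V, ∀ w', BetaEq w' w → ∃ σ' ∈ V', σ' 0 = σ 0 ∧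
        (c ∈ a ∧ WHRed (appN (w'.subst (envSub (a.map (subst σ)))) (bs.map (subst σ)))
            ((appN c cs).subst σ') ∨
          Relation.TransGen WHStep
            (appN (w'.subst (envSub (a.map (subst σ)))) (bs.map (subst σ)))
            ((appN c cs).subst σ')) := by
  induction h generalizing Δ V s a bs with
  | ax hA =>
    obtain ⟨c, hc, hcA⟩ := ha.get hA
    -- Possibly no redex is contracted here; the gain is that `c` comes from the environment.
    refine ⟨Δ, V, c, bs, hW, hbs.hasType hcA, fun σ hσ w' hw' => ⟨σ, hσ, rfl, Or.inl ⟨?_, ?_⟩⟩⟩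
    · exact List.mem_of_getElem? hc
    · rw [subst_appN]
      have := hw'.whRed_var.subst (envSub (a.map (subst σ)))
      rw [subst, envSub_eq (c := c.subst σ) (by simp [hc])] at this
      exact this.appN _
  | @arrI Γ u B C _ ih =>
    simp only [Ty.star, Ty.gsub] at hbs
    cases hbs with
    | @cons _ _ b bs hb hbs =>
      obtain ⟨Δ', V', c, cs, h₁, h₂, h₃⟩ := ih (normal_lam.1 hn) hW (a := b :: a) (.cons hb ha) hbs
      refine ⟨Δ', V', c, cs, h₁, h₂, fun σ hσ w' hw' => ?_⟩
      obtain ⟨u', hu', hu⟩ := hw'.whRed_lam hn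
      obtain ⟨σ', hσ', h0, h⟩ := h₃ σ hσ u' hu
      refine ⟨σ', hσ', h0, Or.inr ?_⟩
      have hred := (hu'.subst (envSub (a.map (subst σ)))).appN ((b :: bs).map (subst σ))
      refine Relation.TransGen.trans_right hred (Relation.TransGen.head' ?_
        (h.elim (fun h => h.2) Relation.TransGen.to_reflTransGen))
      have := (WHStep.beta (u'.subst (liftSub (envSub (a.map (subst σ))))) (b.subst σ)).appN
        (bs.map (subst σ))
      rwa [inst_subst_liftSub] at this
  | @arrE Γ u v B C _ hv ihu _ =>
    obtain ⟨hnu, hnv, -⟩ := normal_app.1 hn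
    -- The argument is not evaluated: it becomes a closure over the same environment, named by the
    -- fresh variable `Δ.length`.
    have hW' := hW.push hv hnv ha
    have hsp : Spine (Δ ++ [Ty.gsub Ty.bot s B.star]) (Ty.gsub Ty.bot s (Ty.arr B C).star)
        (var Δ.length :: bs) :=
      .cons (.ax (by simp)) (hbs.append _)
    obtain ⟨Δ', V', c, cs, h₁, h₂, h₃⟩ := ihu hnu hW' (ha.append _) hsp
    refine ⟨Δ', V', c, cs, h₁, h₂, fun σ hσ w' hw' => ?_⟩
    obtain ⟨u', v', hred, hu', hv'⟩ := hw'.whRed_app hn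
    -- The fresh variable receives the real argument `v'`, which depends on `w'`, closed over the
    -- real environment. Values beyond `Δ.length` do not matter.
    let σ₁ : ℕ → Term := fun n =>
      if n < Δ.length then σ n else v'.subst (envSub (a.map (subst σ)))
    have hag : ∀ n < Δ.length, σ₁ n = σ n := fun n hn => if_pos hn
    have hlen : σ₁ Δ.length = v'.subst (envSub (a.map (subst σ))) := if_neg (lt_irrefl _)
    obtain ⟨σ', hσ', h0, h⟩ := h₃ σ₁ ⟨σ, hσ, hag, v', hv', hlen⟩ u' hu'
    rw [ha.below.map_subst_congr hag, List.map_cons, hbs.args_below.map_subst_congr hag, subst,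
      hlen] at h
    have hred' := (hred.subst (envSub (a.map (subst σ)))).appN (bs.map (subst σ))
    refine ⟨σ', hσ', h0.trans (hag 0 hW.length_pos), ?_⟩
    rcases h with ⟨hc, h⟩ | h
    · exact Or.inl ⟨hc, hred'.trans h⟩
    · exact Or.inr (Relation.TransGen.trans_right hred' h)
  | allI _ ih =>
    simp only [Ty.star, Ty.gsub] at hbs
    cases hbs with
    | inst D hbs =>
      have e : Ty.shift Ty.bot = Ty.bot := rfl
      rw [e, Ty.inst_gsub_liftSub] at hbs
      exact ih hn hW (ha.of_shift D) hbs

/-- Every term of type `⊥` that some valuation makes strongly normalizing evaluates to the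
continuation applied to a term of type `S`, which does not depend on the valuation. -/
theorem World.eval {S : Ty} {Δ : List Ty} {V : Set (ℕ → Term)} (hW : World S Δ V) {M : Term}
    (hM : HasType Δ M Ty.bot) {σ : ℕ → Term} (hσ : σ ∈ V) (hsn : SN (M.subst σ)) :
    ∃ Δ' V' τ, World S Δ' V' ∧ HasType Δ' τ S ∧
      ∀ σ ∈ V, ∃ σ', WHRed (M.subst σ) (app (σ 0) (τ.subst σ')) := by
  -- The induction is on a real term `R` that reduces to the current state under one valuation, so
  -- that world, state and valuation may all change along the run.
  suffices H : ∀ R, SN R → ∀ {Δ V M σ}, World S Δ V → HasType Δ M Ty.bot → σ ∈ V →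
      WHRed R (M.subst σ) → ∃ Δ' V' τ, World S Δ' V' ∧ HasType Δ' τ S ∧
        ∀ σ ∈ V, ∃ σ', WHRed (M.subst σ) (app (σ 0) (τ.subst σ')) from
    H _ hsn hW hM hσ .refl
  clear hW hM hσ hsn Δ V M σ
  intro R hR
  induction hR with
  | intro R _ ihR =>
    have hstrict : ∀ {Δ V M σ}, World S Δ V → HasType Δ M Ty.bot → σ ∈ V →
        Relation.TransGen WHStep R (M.subst σ) → ∃ Δ' V' τ, World S Δ' V' ∧ HasType Δ' τ S ∧
          ∀ σ ∈ V, ∃ σ', WHRed (M.subst σ) (app (σ 0) (τ.subst σ')) := by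
      intro Δ V M σ hW hM hσ h
      obtain ⟨R', h₁, h₂⟩ := Relation.TransGen.head'_iff.1 h
      exact ihR R' h₁.step hW hM hσ h₂
    -- While `R` stays put, a second induction runs on a strict bound `p` for the head variable.
    have hbound : ∀ p, ∀ {Δ V M σ}, World S Δ V → HasType Δ M Ty.bot → σ ∈ V →
        R = M.subst σ → (∀ x cs, unwind M [] = some (x, cs) → x < p) →
        ∃ Δ' V' τ, World S Δ' V' ∧ HasType Δ' τ S ∧
          ∀ σ ∈ V, ∃ σ', WHRed (M.subst σ) (app (σ 0) (τ.subst σ')) := by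
      intro p
      induction p using Nat.strong_induction_on with
      | _ p ihp =>
        intro Δ V M σ hW hM hσ hR hp
        rcases whStep_or_lam_or_unwind M with ⟨M', hM'⟩ | ⟨u, rfl⟩ | hx
        · obtain ⟨Δ', V', τ, h₁, h₂, h₃⟩ := hstrict hW (hM.step hM'.step) hσ
            (by rw [hR]; exact .single (hM'.subst σ))
          refine ⟨Δ', V', τ, h₁, h₂, fun σ hσ => ?_⟩
          obtain ⟨σ', h⟩ := h₃ σ hσ
          exact ⟨σ', h.head (hM'.subst σ)⟩
        · cases hM.lamType
        · obtain ⟨x, bs, hx⟩ := hx []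
          obtain ⟨D, hD, hsp⟩ := hM.spine hx
          have hMx : M = appN (var x) bs := appN_eq_of_unwind hx
          cases x with
          | zero =>
            rw [hW.zero] at hD
            cases hD
            cases hsp with
            | @cons _ _ τ _ hτ hsp =>
              cases hsp
              refine ⟨Δ, V, τ, hW, hτ, fun σ _ => ⟨σ, ?_⟩⟩
              rw [hMx]
              exact .refl
          | succ q =>
            obtain ⟨w, a, Γ, A, s, h₁, h₂, rfl, h₄, h₅⟩ := hW.closure q D hD
            have ha : EnvType Δ s a Γ := by
              have := h₄.append (Δ.drop (q + 1))
              rwa [List.take_append_drop] at this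
            obtain ⟨Δ', V', c, cs, k₁, k₂, k₃⟩ := h₁.unfold_closure h₂ hW ha hsp
            have hsub : ∀ (σ : ℕ → Term) (w' : Term), σ (q + 1) = w'.subst (envSub (a.map (subst σ))) →
                M.subst σ = appN (w'.subst (envSub (a.map (subst σ)))) (bs.map (subst σ)) := by
              intro σ w' e
              rw [hMx, subst_appN, subst, e]
            -- The chosen `σ` serves only to justify the recursive call; its conclusion covers all
            -- valuations in `V'`.
            have hrec : ∃ Δ'' V'' τ, World S Δ'' V'' ∧ HasType Δ'' τ S ∧
                ∀ σ ∈ V', ∃ σ', WHRed ((appN c cs).subst σ) (app (σ 0) (τ.subst σ')) := by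
              obtain ⟨w', hw', e⟩ := h₅ σ hσ
              obtain ⟨σ', hσ', -, h⟩ := k₃ σ hσ w' hw'
              rw [← hsub σ w' e, ← hR] at h
              rcases h with ⟨hc, h⟩ | h
              · rcases Relation.reflTransGen_iff_eq_or_transGen.1 h with h | h
                -- No contraction took place, so the new head lies in the environment of closure `q
                -- + 1`, whose variables are all below `q + 1`.
                · refine ihp (q + 1) (hp _ _ hx) k₁ k₂ hσ' h.symm fun y ds hy => ?_
                  rw [unwind_appN] at hy
                  have := h₄.below c hc y (isFree_of_unwind hy)
                  rw [List.length_take] at this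
                  omega
                · exact hstrict k₁ k₂ hσ' h
              · exact hstrict k₁ k₂ hσ' h
            obtain ⟨Δ'', V'', τ, m₁, m₂, m₃⟩ := hrec
            refine ⟨Δ'', V'', τ, m₁, m₂, fun σ hσ => ?_⟩
            obtain ⟨w', hw', e⟩ := h₅ σ hσ
            obtain ⟨σ', hσ', h0, h⟩ := k₃ σ hσ w' hw'
            obtain ⟨σ'', h''⟩ := m₃ σ' hσ'
            refine ⟨σ'', ?_⟩
            rw [← hsub σ w' e] at h
            rw [← h0]
            exact (h.elim (fun h => h.2) Relation.TransGen.to_reflTransGen).trans h''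
    intro Δ V M σ hW hM hσ h
    rcases Relation.reflTransGen_iff_eq_or_transGen.1 h with h | h
    · rcases hu : unwind M [] with _ | ⟨y, ds⟩
      · exact hbound 0 hW hM hσ h.symm fun x cs hx => by rw [hu] at hx; cases hx
      · refine hbound (y + 1) hW hM hσ h.symm fun x cs hx => ?_
        rw [hu] at hx
        cases hx
        exact Nat.lt_succ_self _
    · exact hstrict hW hM hσ h

/-! ### Closedness of the stored term. -/

namespace Term

/-- The term `λ … λ z` with `k` abstractions that do not bind `z`. -/
def konst : ℕ → ℕ → Term
  | 0, z => var z
  | k + 1, z => lam (konst k (z + 1))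

theorem rename_konst (r : ℕ → ℕ) (k z : ℕ) : rename r (konst k z) = konst k (r z) := by
  induction k generalizing r z with
  | zero => rfl
  | succ k ih => simp only [konst, rename, ih]; rfl

theorem subst_konst {s : ℕ → Term} {z y : ℕ} (h : s z = var y) (k : ℕ) :
    subst s (konst k z) = konst k y := by
  induction k generalizing s z y with
  | zero => exact h
  | succ k ih =>
    simp only [konst, subst]
    rw [ih (y := y + 1)]
    simp only [liftSub, h]
    rfl

theorem isFree_konst (k z : ℕ) : IsFree z (konst k z) := by
  induction k generalizing z with
  | zero => rfl
  | succ k ih => exact ih (z + 1)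

theorem normal_konst (k z : ℕ) : Normal (konst k z) := by
  induction k generalizing z with
  | zero => exact normal_var z
  | succ k ih => exact normal_lam.2 (ih (z + 1))

/-- When a free variable of a normal term is replaced by `λ … λ z`, the variable `z` is free in
the normal form of the result. -/
theorem Normal.exists_normal_subst_konst {t : Term} (ht : Normal t) {s : ℕ → Term} {z : ℕ}
    (hs : ∀ p, (∃ k, s p = konst k z) ∨ ∃ q, s p = var q) :
    ∃ N, Red (subst s t) N ∧ Normal N ∧
      (∀ p k, IsFree p t → s p = konst k z → IsFree z N) ∧
      ((∀ v, t ≠ lam v) → (∀ v, N ≠ lam v) ∨ ∃ k, N = konst k z) := by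
  induction t generalizing s z with
  | var n =>
    refine ⟨s n, .refl, ?_, ?_, fun _ => ?_⟩
    · rcases hs n with ⟨k, e⟩ | ⟨q, e⟩
      · rw [e]; exact normal_konst k z
      · rw [e]; exact normal_var q
    · rintro p k rfl e
      rw [e]
      exact isFree_konst k z
    · rcases hs n with ⟨k, e⟩ | ⟨q, e⟩
      · exact Or.inr ⟨k, e⟩
      · rw [e]; exact Or.inl fun _ h => by cases h
  | app t u iht ihu =>
    obtain ⟨h₁, h₂, h₃⟩ := normal_app.1 ht
    obtain ⟨N, hN, hNn, hNf, hNl⟩ := iht h₁ hs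
    obtain ⟨P, hP, hPn, hPf, -⟩ := ihu h₂ hs
    have hplain : (∀ v, N ≠ lam v) → ∃ N, Red (subst s (app t u)) N ∧ Normal N ∧
        (∀ p k, IsFree p (app t u) → s p = konst k z → IsFree z N) ∧
        ((∀ v, app t u ≠ lam v) → (∀ v, N ≠ lam v) ∨ ∃ k, N = konst k z) := by
      intro hl
      refine ⟨app N P, hN.app hP, normal_app.2 ⟨hNn, hPn, hl⟩, ?_, fun _ => ?_⟩
      · rintro p k (hp | hp) e
        · exact Or.inl (hNf p k hp e)
        · exact Or.inr (hPf p k hp e)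
      · exact Or.inl fun _ h => by cases h
    rcases hNl h₃ with hl | ⟨k, rfl⟩
    · exact hplain hl
    · cases k with
      | zero => exact hplain fun _ h => by cases h
      | succ k =>
        -- A vacuous abstraction swallows the argument, and with it any free variable of that
        -- argument; `z` itself remains.
        refine ⟨konst k z, (hN.app hP).tail ?_, normal_konst k z, fun _ _ _ _ => isFree_konst k z,
          fun _ => Or.inr ⟨k, rfl⟩⟩
        have h := Step.beta (konst k (z + 1)) P
        rwa [inst, subst_konst (s := single P) (z := z + 1) (y := z) rfl] at h
  | lam t ih =>
    obtain ⟨N, hN, hNn, hNf, -⟩ := ih (normal_lam.1 ht) (s := liftSub s) (z := z + 1) (by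
      intro p
      cases p with
      | zero => exact Or.inr ⟨0, rfl⟩
      | succ p =>
        rcases hs p with ⟨k, e⟩ | ⟨q, e⟩
        · exact Or.inl ⟨k, by rw [liftSub, e, rename_konst]⟩
        · exact Or.inr ⟨q + 1, by rw [liftSub, e]; rfl⟩)
    refine ⟨lam N, hN.lam, normal_lam.2 hNn, fun p k hp e => ?_, fun h => absurd rfl (h t)⟩
    exact hNf (p + 1) k hp (by rw [liftSub, e, rename_konst])

end Term

/-- Every translated type has `⊥` as its final target, since its atoms are negations. Once `⊥`
becomes `c`, it suffices to discard all arguments and return `z : c`. -/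
theorem exists_hasType_konst (A : Ty) {Γ : List Ty} {z : ℕ} {c : Ty} (hz : Γ[z]? = some c)
    (s : ℕ → Ty) : ∃ k, HasType Γ (konst k z) (Ty.gsub c s A.star) := by
  induction A generalizing Γ z c s with
  | var n => exact ⟨1, .arrI (.ax (List.getElem?_cons_succ.trans hz))⟩
  | cst d => exact ⟨1, .arrI (.ax (List.getElem?_cons_succ.trans hz))⟩
  | arr A B _ ihB =>
    obtain ⟨k, hk⟩ := ihB (Γ := Ty.gsub c s A.star :: Γ) (z := z + 1) (by simpa using hz) s
    exact ⟨k + 1, .arrI hk⟩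
  | all A ih =>
    obtain ⟨k, hk⟩ := ih (Γ := Γ.map Ty.shift) (z := z) (c := c.shift) (by simp [hz]) (Ty.liftSub s)
    exact ⟨k, .allI hk⟩

/-- A normal term of an output type, typed with the variables of a world, is closed. -/
theorem World.closed_of_normal {S : Ty} {Δ : List Ty} {V : Set (ℕ → Term)} (hW : World S Δ V)
    (hS : IsOutput S) (hbot : ¬ S.BotOccurs) {τ : Term} (hτ : HasType Δ τ S) (hn : τ.Normal) :
    τ.Closed := by
  have hk : ∀ p : ℕ, ∃ k, ∀ D, Δ[p]? = some D →
      HasType [Ty.var 0] (konst k 0) (Ty.gsub (Ty.var 0) Ty.var D) := by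
    intro p
    rcases hD : Δ[p]? with _ | D
    · exact ⟨0, fun D h => by cases h⟩
    · have : ∃ k, HasType [Ty.var 0] (konst k 0) (Ty.gsub (Ty.var 0) Ty.var D) := by
        cases p with
        | zero =>
          rw [hW.zero] at hD
          cases hD
          exact ⟨1, .arrI (.ax rfl)⟩
        | succ p =>
          obtain ⟨w, a, Γ, A, s, -, -, rfl, -⟩ := hW.closure p D hD
          rw [Ty.gsub_gsub]
          exact exists_hasType_konst A rfl _
      obtain ⟨k, hk⟩ := this
      exact ⟨k, fun D' h => by cases h; exact hk⟩
  choose k hk using hk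
  have hτ' : HasType [Ty.var 0] (τ.subst fun p => konst (k p) 0) S := by
    have := (hτ.gsub (Ty.var 0) Ty.var).subst (Γ' := [Ty.var 0]) (s := fun p => konst (k p) 0) (by
      intro n B hB
      simp only [List.getElem?_map, Option.map_eq_some_iff] at hB
      obtain ⟨D, hD, rfl⟩ := hB
      exact hk n D hD)
    rwa [Ty.gsub_eq_self (fun _ _ => rfl) (Or.inr hbot)] at this
  obtain ⟨N, hN, hNn, hNf, -⟩ :=
    hn.exists_normal_subst_konst (s := fun p => konst (k p) 0) (z := 0) fun p => Or.inl ⟨k p, rfl⟩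
  intro p hp
  -- `N` is a normal term of type `S` in the context `z : X`, because `S` is untouched by the
  -- replacement of `⊥`; a free variable of `τ` would make `z` free in it.
  refine hS.2 N hNn (.allI (.arrI ?_)) (hNf p (k p) hp rfl)
  rw [hS.1.shift_eq]
  exact hτ'.red hN

/-! ### The two halves of the theorem. -/

theorem isStorageOperator_of_hasType {E S : Ty} (hE : IsInput E) (hS : IsOutput S)
    (hbot : ¬ S.BotOccurs) {T : Term} (hT : HasType [] T (Ty.arr E.star S.neg.neg)) :
    IsStorageOperator T E S := by
  refine ⟨hT.closed, fun t ht => ?_⟩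
  obtain ⟨t₀, hred, hn, ht₀⟩ := ht.exists_normal
  have h₀ := hE.2 t₀ hn ht₀
  have hW₀ : World S [S.neg] Set.univ := ⟨rfl, fun p D hD => by simp at hD⟩
  have hW := hW₀.push h₀ hn (a := []) (s := Ty.var) .nil
  have hM : HasType ([S.neg] ++ [Ty.gsub Ty.bot Ty.var E.star]) (app (app T (var 1)) (var 0))
      Ty.bot := by
    rw [Ty.gsub_bot_var]
    exact .arrE (.arrE (hT.append [S.neg, E.star]) (.ax rfl)) (.ax rfl)
  have hsubst : ∀ (θ : Term) (f : ℕ), (app (app T (var 1)) (var 0)).subst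
      (scons (var f) (scons θ var)) = app (app T θ) (var f) := by
    intro θ f
    simp only [subst, hT.closed.subst_eq]
    rfl
  -- Variable 0 is the continuation and variable 1 the input closure, with code `t₀` and empty
  -- environment; each choice of `θ` and `f` is one valuation.
  have hV : ∀ (θ : Term) (f : ℕ), BetaEq θ t₀ → scons (var f) (scons θ var) ∈
      {σ' : ℕ → Term | ∃ σ ∈ (Set.univ : Set (ℕ → Term)), (∀ n < [S.neg].length, σ' n = σ n) ∧
        ∃ w', BetaEq w' t₀ ∧ σ' [S.neg].length = w'.subst (envSub (([] : List Term).map (subst σ)))} :=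
    fun θ f hθ => ⟨_, Set.mem_univ _, fun _ _ => rfl, θ, hθ, (subst_var θ).symm⟩
  -- Termination is tested on `t₀`, which has type `E*`; an arbitrary `θ` need not be typable or
  -- strongly normalizing.
  have hsn : SN ((app (app T (var 1)) (var 0)).subst (scons (var 0) (scons t₀ var))) := by
    rw [hsubst]
    have h : HasType [S.neg] (app (app T t₀) (var 0)) Ty.bot :=
      .arrE (.arrE (hT.append [S.neg]) (h₀.star.append [S.neg])) (.ax rfl)
    exact h.sn
  obtain ⟨Δ, V, τ, hW', hτ, hev⟩ := hW.eval hM (hV t₀ 0 (.refl _)) hsn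
  obtain ⟨τ', hττ', hn', hτ'⟩ := hτ.exists_normal
  have hcl := hW'.closed_of_normal hS hbot hτ' hn'
  refine ⟨τ, τ', hττ'.betaEq, hτ'.congr_ctx fun n h => absurd h (hcl n), fun θ hθ f _ => ?_⟩
  obtain ⟨σ', h⟩ := hev _ (hV θ f (hθ.trans hred.betaEq))
  rw [hsubst] at h
  exact ⟨σ', h⟩

namespace Term

/-- At `p` the two substitutions have the same variable, or the first has an abstraction and
the second an application. -/
def Separated (r₁ r₂ : ℕ → Term) (p : ℕ) : Prop :=
  (∃ q, r₁ p = var q ∧ r₂ p = var q) ∨ ∃ a b c, r₁ p = lam a ∧ r₂ p = app b c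

theorem Separated.liftSub {r₁ r₂ : ℕ → Term} (h : ∀ p, Separated r₁ r₂ p) (p : ℕ) :
    Separated (liftSub r₁) (liftSub r₂) p := by
  cases p with
  | zero => exact Or.inl ⟨0, rfl, rfl⟩
  | succ p =>
    rcases h p with ⟨q, e₁, e₂⟩ | ⟨a, b, c, e₁, e₂⟩
    · exact Or.inl ⟨q + 1, by simp [Term.liftSub, e₁, rename], by simp [Term.liftSub, e₂, rename]⟩
    · exact Or.inr ⟨_, _, _, by simp only [Term.liftSub, e₁, rename]; rfl,
        by simp only [Term.liftSub, e₂, rename]; rfl⟩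

theorem exists_lam_of_subst {r₁ r₂ : ℕ → Term} (h : ∀ p, Separated r₁ r₂ p) {u a : Term}
    (e : subst r₂ u = lam a) : ∃ c, u = lam c := by
  cases u with
  | var p =>
    rcases h p with ⟨q, -, e₂⟩ | ⟨_, _, _, -, e₂⟩ <;>
    · rw [subst, e₂] at e
      cases e
  | app c d => cases e
  | lam c => exact ⟨c, rfl⟩

/-- A common generalization of two separated instances of a normal term `u` is normal, and it has
a variable above the position of each variable of `u` that separates the instances. -/
theorem normal_of_separated {τ u : Term} {s₁ s₂ r₁ r₂ : ℕ → Term} {n : ℕ}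
    (hs : ∀ p < n, s₁ p = var p) (hr : ∀ p, Separated r₁ r₂ p)
    (h₁ : subst s₁ τ = subst r₁ u) (h₂ : subst s₂ τ = subst r₂ u) (hu : Normal u) :
    Normal τ ∧ ∀ p a, IsFree p u → r₁ p = lam a → ∃ y ≥ n, IsFree y τ := by
  induction τ generalizing u s₁ s₂ r₁ r₂ n with
  -- Indices below `n` are bound by the abstractions already crossed and are fixed by `s₁`; at such
  -- a place `u` cannot have a variable that `r₁` sends to an abstraction.
  | var y =>
    refine ⟨normal_var y, fun p a hp e => ?_⟩
    by_cases hy : y < n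
    · rw [subst, hs y hy] at h₁
      cases u with
      | var m =>
        cases hp
        rw [subst, e] at h₁
        cases h₁
      | app c d => cases h₁
      | lam c => cases h₁
    · exact ⟨y, not_lt.1 hy, rfl⟩
  | app a b iha ihb =>
    cases u with
    | var m =>
      rcases hr m with ⟨q, e, -⟩ | ⟨_, _, _, e, -⟩ <;>
      · rw [subst, subst, e] at h₁
        cases h₁
    | lam c => cases h₁
    | app c d =>
      obtain ⟨hc, hd, hl⟩ := normal_app.1 hu
      simp only [subst, app.injEq] at h₁ h₂
      obtain ⟨hna, hfa⟩ := iha hs hr h₁.1 h₂.1 hc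
      obtain ⟨hnb, hfb⟩ := ihb hs hr h₁.2 h₂.2 hd
      refine ⟨normal_app.2 ⟨hna, hnb, ?_⟩, ?_⟩
      · rintro v rfl
        -- The second substitution never creates an abstraction, so a redex of `τ` would already be
        -- a redex of `u`.
        obtain ⟨c', rfl⟩ := exists_lam_of_subst hr h₂.1.symm
        exact hl c' rfl
      · rintro p e (hp | hp) hpe
        · obtain ⟨y, hy, hf⟩ := hfa p e hp hpe
          exact ⟨y, hy, Or.inl hf⟩
        · obtain ⟨y, hy, hf⟩ := hfb p e hp hpe
          exact ⟨y, hy, Or.inr hf⟩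
  | lam a iha =>
    obtain ⟨c, rfl⟩ := exists_lam_of_subst hr h₂.symm
    simp only [subst, lam.injEq] at h₁ h₂
    have hs' : ∀ p < n + 1, liftSub s₁ p = var p := by
      intro p hp
      cases p with
      | zero => rfl
      | succ p => rw [liftSub, hs p (by omega)]; rfl
    obtain ⟨hna, hfa⟩ := iha hs' (Separated.liftSub hr) h₁ h₂ (normal_lam.1 hu)
    refine ⟨normal_lam.2 hna, fun p e hp hpe => ?_⟩
    obtain ⟨y, hy, hf⟩ := hfa (p + 1) _ hp (by simp only [liftSub, hpe, rename]; rfl)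
    obtain ⟨y, rfl⟩ : ∃ m, y = m + 1 := ⟨y - 1, by omega⟩
    exact ⟨y, by omega, hf⟩

end Term

theorem exists_not_isStorageOperator {E S : Ty} (hS : S.Closed) {t : Term} (ht : HasType [] t E)
    (hout : ¬ IsOutput S) : ∃ T : Term, HasType [] T (Ty.arr E.star S.neg.neg) ∧
      ¬ IsStorageOperator T E S := by
  obtain ⟨u, hu, hty, hfree⟩ : ∃ u : Term, u.Normal ∧
      HasType [] (lam u) (Ty.all (Ty.arr (Ty.var 0) S.shift)) ∧ u.IsFree 0 := by
    by_contra h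
    push Not at h
    exact hout ⟨hS, h⟩
  have hu' : HasType [E.star] u S := by
    have h := (HasType.allE E.star hty).lamType
    rw [show Ty.inst (Ty.arr (Ty.var 0) S.shift) E.star =
      Ty.arr E.star (Ty.inst S.shift E.star) from rfl, Ty.inst_shift] at h
    cases h with
    | arr h => exact h
  -- The operator `λx λf. f u`, which passes its input on unevaluated.
  refine ⟨lam (lam (app (var 0) (rename Nat.succ u))), ?_, ?_⟩
  · refine .arrI (.arrI (.arrE (B := S) (.ax rfl) (hu'.rename fun n B hB => ?_)))
    simpa using hB
  · rintro ⟨-, hT⟩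
    obtain ⟨τ, τ', hττ', hτ', hstore⟩ := hT t ht
    obtain ⟨t₀, hred, hn, ht₀⟩ := ht.exists_normal
    obtain ⟨a, rfl⟩ : ∃ a, t₀ = lam a := by
      by_contra h
      push Not at h
      obtain ⟨n, hn⟩ := hn.exists_isFree h
      exact ht₀.closed n hn
    have hinst : ∀ θ, BetaEq θ t → θ.Closed → ∃ σ, subst σ τ = subst (single θ) u := by
      intro θ hθ hcl
      obtain ⟨σ, hσ⟩ := hstore θ hθ 0 (hcl 0)
      have hrun : WHRed (app (app (lam (lam (app (var 0) (rename Nat.succ u)))) θ) (var 0))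
          (app (var 0) (inst u θ)) := by
        refine .head (.app _ (.beta _ _)) (.head (b := app (var 0) (inst u θ)) ?_ .refl)
        have h := WHStep.beta (app (var 0) (rename Nat.succ (inst u θ))) (var 0)
        rw [show inst (app (var 0) (rename Nat.succ (inst u θ))) (var 0) =
          app (var 0) (inst (rename Nat.succ (inst u θ)) (var 0)) from rfl, inst_rename_succ] at h
        convert h using 2
        simp only [inst, subst, subst_rename, rename_subst]
        rfl
      have hhalt : ∀ b w, ¬ WHStep (app (var 0) b) w := by
        intro b w h
        cases h with
        | app _ h => cases h
      exact ⟨σ, (app.inj (WHRed.eq_of_halted hσ hrun (hhalt _) (hhalt _))).2⟩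
    have hcl : Term.Closed (lam a) := ht₀.closed
    obtain ⟨σ₁, h₁⟩ := hinst (lam a) hred.betaEq.symm hcl
    -- `(λy y) t₀` is β-equivalent to `t₀` but is an application, which separates the two instances
    -- at each occurrence of `x`.
    obtain ⟨σ₂, h₂⟩ := hinst (app (lam (var 0)) (lam a))
      ((Relation.EqvGen.rel _ _ (.beta (var 0) (lam a))).trans _ _ _ hred.betaEq.symm)
      (fun n h => h.elim (fun h => by cases h) (hcl n))
    obtain ⟨hnτ, hfτ⟩ := normal_of_separated (n := 0) (fun p hp => absurd hp (Nat.not_lt_zero p))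
      (fun p => by
        cases p with
        | zero => exact Or.inr ⟨_, _, _, rfl, rfl⟩
        | succ p => exact Or.inl ⟨p, rfl, rfl⟩) h₁ h₂ hu
    obtain ⟨y, -, hy⟩ := hfτ 0 a hfree rfl
    -- As `τ` is normal, the closed `τ'` reduces to it, and reduction creates no free variables.
    exact hτ'.closed y ((hττ'.symm.red hnτ).isFree hy)

end SystemF

theorem mainTheorem4 :
    (∀ E S : SystemF.Ty, E.Proper → S.Proper →
      SystemF.IsInput E → SystemF.IsOutput S → ¬ S.BotOccurs →
      ∀ T : SystemF.Term, SystemF.HasType [] T (SystemF.Ty.arr E.star S.neg.neg) →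
        SystemF.IsStorageOperator T E S) ∧
    (∀ E S : SystemF.Ty, E.Proper → S.Proper → E.Closed → S.Closed →
      (∃ t : SystemF.Term, SystemF.HasType [] t E) → ¬ SystemF.IsOutput S →
      ∃ T : SystemF.Term, SystemF.HasType [] T (SystemF.Ty.arr E.star S.neg.neg) ∧
        ¬ SystemF.IsStorageOperator T E S) :=
  ⟨fun _ _ _ _ hE hS hbot _ hT => SystemF.isStorageOperator_of_hasType hE hS hbot hT,
    fun _ _ _ _ _ hS ⟨_, ht⟩ hout => SystemF.exists_not_isStorageOperator hS ht hout⟩
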